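/- **Conventions.** Let $n\ge 1$. A convex body in $\mathbb R^n$ is a compact convex set with the origin in its interior. For convex bodies $K,T\subset\mathbb R^n$ put $T^\circ=\{x:\langle x,y\rangle\le 1\ \forall y\in T\}$, $N_T(z)=\{v:\langle v,y-z\rangle\le 0\ \forall y\in T\}$, and let $\mu_C(x)=\min\{s\ge 0: x\in sC\}$ be the Minkowski functional of a convex body $C$. * For a convex body $C\subset\mathbb R^{2n}$ let $H_C=\tfrac12\mu_C^2$, let $\partial H_C$ be its subdifferential, and let $J(q,p)=(p,-q)$. A *closed characteristic* on $\partial C$ is, for some period $\tau>0$, an absolutely continuous $\tau$-periodic curve $x:\mathbb R\to\mathbb R^{2n}$ with $\dot x(t)\in J\partial H_C(x(t))$ for a.e. $t$ and $H_C(x(t))=\tfrac12$ for all $t$. Its action is $\mathbb A(x)=-\tfrac12\int_0^\tau\langle J\dot x(t),x(t)\rangle\,dt$, and $c_{EHZ}(C)=\min\{\mathbb A(x): x \text{ a closed characteristic on }\partial C\}$. * A *closed polygonal curve* $q=(q_1,\dots,q_m)$, $m\ge 2$ (indices mod $m$), is required to satisfy $q_j\ne q_{j+1}$ and $q_j\notin[q_{j-1},q_{j+1}]$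 for all $j$. Its $\ell_T$-length is $\ell_T(q)=\sum_{j=1}^m\mu_{T^\circ}(q_{j+1}-q_j)$. * $F^{cp}_{n+1}(K)$ is the set of closed polygonal curves with at most $n+1$ vertices that cannot be translated into the interior of $K$. * A closed polygonal curve $q$ with vertices on $\partial K$ is a *closed (strong) $(K,T)$-Minkowski billiard trajectory* if there are $p_1,\dots,p_m\in\partial T$ with $q_{j+1}-q_j\in N_T(p_j)$ and $p_{j+1}-p_j\in -N_K(q_{j+1})$ for all $j$. $M_{n+1}(K,T)$ is the set of those with $m\le n+1$. **Theorem 1.1.** Let $K,T\subset\mathbb R^n$ be arbitrary convex bodies (no smoothness or strict convexity is assumed), and regard $K\times T\subset\mathbb R^n_q\times\mathbb R^n_p=\mathbb R^{2n}$ as a Lagrangian product. Then the following minima all exist, and $$c_{EHZ}(K\times T)=\min_{q\in F^{cp}_{n+1}(K)}\ell_T(q)=\min_{p\in F^{cp}_{n+1}(T)}\ell_K(p)=\min_{q\in M_{n+1}(K,T)}\ell_T(q),$$ where the existence of the minimum defining $c_{EHZ}(K\times T)$ is included. -/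

import Mathlib

noncomputable section

namespace MinkowskiBilliards

open MeasureTheory

section Convex

variable {V : Type*} [NormedAddCommGroup V] [InnerProductSpace ℝ V]

/-- The polar body `T° = {x | ⟨x, y⟩ ≤ 1 for all y ∈ T}`. -/
def polarBody (T : Set V) : Set V := {x | ∀ y ∈ T, inner ℝ x y ≤ 1}

/-- The outer normal cone `N_T(z) = {v | ⟨v, y - z⟩ ≤ 0 for all y ∈ T}`. -/
def normalCone (T : Set V) (z : V) : Set V := {v | ∀ y ∈ T, inner ℝ v (y - z) ≤ 0}

/-- The subdifferential `∂H(x)` of convex analysis. -/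
def subdifferential (H : V → ℝ) (x : V) : Set V := {ξ | ∀ y, H x + inner ℝ ξ (y - x) ≤ H y}

/-- `H_C = μ_C² / 2`, where `μ_C` is the Minkowski functional (`gauge`) of `C`. -/
def hamiltonian (C : Set V) (x : V) : ℝ := gauge C x ^ 2 / 2

end Convex

section Capacity

variable {E : Type*} [NormedAddCommGroup E] [InnerProductSpace ℝ E]

/-- The phase space `E_q × E_p` with its Euclidean (`L²`) inner product; for `E = ℝⁿ` this is
`ℝ²ⁿ` with its standard inner product. -/
abbrev PhaseSpace (E : Type*) : Type _ := WithLp 2 (E × E)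

/-- The symplectic matrix `J (q, p) = (p, -q)`. -/
def J (x : PhaseSpace E) : PhaseSpace E := WithLp.toLp 2 (x.snd, -x.fst)

/-- The Lagrangian product `K × T`, with `K` in the `q`- and `T` in the `p`-coordinates. -/
def lagrangianProduct (K T : Set E) : Set (PhaseSpace E) := {x | x.fst ∈ K ∧ x.snd ∈ T}

/-- `x` is a closed characteristic on `∂C` of period `τ > 0`: an absolutely continuous
`τ`-periodic curve with `ẋ ∈ J ∂H_C(x)` almost everywhere and `H_C(x) = 1/2` everywhere. -/
structure IsClosedCharacteristic (C : Set (PhaseSpace E)) (τ : ℝ) (x : ℝ → PhaseSpace E) :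
    Prop where
  period_pos : 0 < τ
  periodic : Function.Periodic x τ
  absolutelyContinuous : AbsolutelyContinuousOnInterval x 0 τ
  inclusion : ∀ᵐ t : ℝ, ∃ ξ ∈ subdifferential (hamiltonian C) (x t), HasDerivAt x (J ξ) t
  energy : ∀ t, hamiltonian C (x t) = 1 / 2

/-- The action `𝔸(x) = -1/2 ∫ ⟨J ẋ(t), x(t)⟩ dt` of a loop of period `τ`. -/
def action (τ : ℝ) (x : ℝ → PhaseSpace E) : ℝ :=
  -(1 / 2) * ∫ t in (0 : ℝ)..τ, inner ℝ (J (deriv x t)) (x t)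

/-- The set of all actions of closed characteristics on `∂C`. -/
def characteristicActions (C : Set (PhaseSpace E)) : Set ℝ :=
  {A | ∃ τ x, IsClosedCharacteristic C τ x ∧ A = action τ x}

/-- The EHZ-capacity: the minimal action of a closed characteristic on `∂C`. (As with every `sInf`
of reals, that the minimum is attained is a separate assertion.) -/
def cEHZ (C : Set (PhaseSpace E)) : ℝ := sInf (characteristicActions C)

end Capacity

section Billiards

variable {E : Type*} [NormedAddCommGroup E] [InnerProductSpace ℝ E]

/-- A closed polygonal curve with vertices `q_j`, `j ∈ Fin m`, `m ≥ 2`. Addition and subtraction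
in `Fin m` are modulo `m`, so `j + 1` and `j - 1` are the cyclic neighbours of `j`. -/
structure ClosedPolygon (E : Type*) [NormedAddCommGroup E] [InnerProductSpace ℝ E] where
  m : ℕ
  [neZero : NeZero m]
  two_le : 2 ≤ m
  vertex : Fin m → E
  ne_next : ∀ j, vertex j ≠ vertex (j + 1)
  notMem_segment : ∀ j, vertex j ∉ segment ℝ (vertex (j - 1)) (vertex (j + 1))

attribute [instance] ClosedPolygon.neZero

/-- The curve itself as a set: the union of its edges. -/
def ClosedPolygon.carrier (q : ClosedPolygon E) : Set E :=
  ⋃ j, segment ℝ (q.vertex j) (q.vertex (j + 1))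

/-- The `ℓ_T`-length `∑_j μ_{T°}(q_{j+1} - q_j)`. -/
def length (T : Set E) (q : ClosedPolygon E) : ℝ :=
  ∑ j, gauge (polarBody T) (q.vertex (j + 1) - q.vertex j)

/-- `F_k^{cp}(K)`: the closed polygonal curves with at most `k` vertices that cannot be translated
into the interior of `K`. -/
def F (k : ℕ) (K : Set E) : Set (ClosedPolygon E) :=
  {q | q.m ≤ k ∧ ∀ v : E, ¬ (fun x => x + v) '' q.carrier ⊆ interior K}

/-- `q` is a closed strong `(K, T)`-Minkowski billiard trajectory. -/
def IsStrongBilliard (K T : Set E) (q : ClosedPolygon E) : Prop :=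
  (∀ j, q.vertex j ∈ frontier K) ∧
    ∃ p : Fin q.m → E, (∀ j, p j ∈ frontier T) ∧
      ∀ j, q.vertex (j + 1) - q.vertex j ∈ normalCone T (p j) ∧
        -(p (j + 1) - p j) ∈ normalCone K (q.vertex (j + 1))

/-- `M_k(K, T)`: the closed strong `(K, T)`-Minkowski billiard trajectories with at most `k`
bouncing points. -/
def M (k : ℕ) (K T : Set E) : Set (ClosedPolygon E) :=
  {q | q.m ≤ k ∧ IsStrongBilliard K T q}

end Billiards

end MinkowskiBilliards

end

noncomputable section

namespace MinkowskiBilliards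

open MeasureTheory Set Filter Topology

/-! ### Support functions, polar gauges and normal cones -/

section Support

variable {V : Type*} [NormedAddCommGroup V] [InnerProductSpace ℝ V]

/-! Write h_K for the support function of K, which is the gauge of its polar. Let L be the least
ℓ_T-length of a loop of n+1 points, degenerate loops allowed, that has no translate in the interior
of K. All four minima equal L.

Compactness gives a minimizer w. By Hahn–Banach, untranslatability of w is certified by vectors n_j,
not all zero, with ∑ n_j = 0 and ∑ h_K(n_j) ≤ ∑ ⟨n_j, w_j⟩. Minimality and homogeneity then give L ∑
⟨n_j, w'_j⟩ ≤ (∑ h_K(n_j)) ℓ_T(w') for every zero-sum family n and every loop w'. Taking w' = w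
places a translate of w inside K. Fixing the certificate and varying w' places a rescaled cyclic
primitive of it, the momenta p, inside T. Equality in the summed support inequalities is exactly the
pair of billiard rules (`exists_weakBilliard_of_minimal`). Deleting degenerate vertices makes the
trajectory strong (`IsWeakBilliard.exists_strong`). The reversed momenta form a loop of the same
length that is untranslatable for T (`IsWeakBilliard.exists_dual_loop`), so exchanging K and T
identifies the two polygon minima.

The action of a closed characteristic is half its period. A strong trajectory lifts to alternating
q- and p-segments, spending time ℓ_T(q) on each kind, hence with action ℓ_T(q). Conversely, along a
characteristic the function (t + ⟨q, p⟩)/2 dominates the ℓ_T-length of q, which is therefore at most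
τ/2 over a period, and q cannot be translated into rK for r < 1. Helly's theorem finds at most n+1
points of q with the same obstruction, and r → 1 gives L ≤ action
(`IsClosedCharacteristic.le_action`). -/

/-- A convex body: a compact convex set with the origin in its interior. -/
structure IsBody (T : Set V) : Prop where
  convex : Convex ℝ T
  isCompact : IsCompact T
  zero_mem_interior : (0 : V) ∈ interior T

namespace IsBody

variable {T : Set V}

lemma zero_mem (hT : IsBody T) : (0 : V) ∈ T := interior_subset hT.zero_mem_interior

lemma mem_nhds (hT : IsBody T) : T ∈ 𝓝 (0 : V) := mem_interior_iff_mem_nhds.1 hT.zero_mem_interior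

lemma absorbent (hT : IsBody T) : Absorbent ℝ T := absorbent_nhds_zero hT.mem_nhds

end IsBody

/-- A linear functional bounded by one on `C` is bounded by the gauge of `C`. -/
lemma inner_le_gauge {C : Set V} (hC : Absorbent ℝ C) {ξ : V} (h : ∀ y ∈ C, inner ℝ ξ y ≤ 1)
    (x : V) : inner ℝ ξ x ≤ gauge C x := by
  rw [gauge_def]
  refine le_csInf hC.gauge_set_nonempty ?_
  rintro r ⟨hr, y, hy, rfl⟩
  rw [inner_smul_right]
  have := mul_le_mul_of_nonneg_left (h y hy) (le_of_lt hr)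
  simpa using this

lemma convex_polarBody (T : Set V) : Convex ℝ (polarBody T) := by
  intro x hx y hy a b ha hb hab z hz
  rw [inner_add_left, inner_smul_left, inner_smul_left]
  have h1 := mul_le_mul_of_nonneg_left (hx z hz) ha
  have h2 := mul_le_mul_of_nonneg_left (hy z hz) hb
  simp only [conj_trivial]
  linarith

variable {T : Set V}

lemma IsBody.polarBody_mem_nhds (hT : IsBody T) : polarBody T ∈ 𝓝 (0 : V) := by
  obtain ⟨R, hR⟩ := hT.isCompact.isBounded.exists_norm_le
  have hR0 : 0 ≤ R := by simpa using hR 0 hT.zero_mem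
  refine mem_of_superset (Metric.ball_mem_nhds (0 : V) (ε := 1 / (R + 1)) (by positivity)) ?_
  intro x hx y hy
  have hx' : ‖x‖ < 1 / (R + 1) := by simpa using hx
  calc inner ℝ x y ≤ ‖x‖ * ‖y‖ := real_inner_le_norm x y
    _ ≤ 1 / (R + 1) * (R + 1) := by
      gcongr
      linarith [hR y hy]
    _ = 1 := by field_simp

lemma IsBody.inner_le (hT : IsBody T) (v : V) {y : V} (hy : y ∈ T) :
    inner ℝ v y ≤ gauge (polarBody T) v := by
  rw [real_inner_comm]
  refine inner_le_gauge (absorbent_nhds_zero hT.polarBody_mem_nhds) (fun x hx ↦ ?_) v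
  rw [real_inner_comm]
  exact hx y hy

/-- The gauge of the polar body is the support function, and its supremum is attained. -/
lemma IsBody.exists_gauge_eq (hT : IsBody T) (v : V) :
    ∃ y ∈ T, gauge (polarBody T) v = inner ℝ v y := by
  obtain ⟨y, hy, hmax⟩ := hT.isCompact.exists_isMaxOn ⟨0, hT.zero_mem⟩
    (f := fun y ↦ inner ℝ v y) (by fun_prop)
  refine ⟨y, hy, le_antisymm ?_ (hT.inner_le v hy)⟩
  have h0 : 0 ≤ inner ℝ v y := by simpa using hmax hT.zero_mem
  refine le_of_forall_pos_le_add fun ε hε ↦ ?_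
  refine gauge_le_of_mem (by positivity) ?_
  have hpos : 0 < inner ℝ v y + ε := by positivity
  refine (mem_smul_set_iff_inv_smul_mem₀ hpos.ne' _ _).2 fun z hz ↦ ?_
  rw [inner_smul_left]
  have : inner ℝ v z ≤ inner ℝ v y := hmax hz
  simp only [conj_trivial]
  rw [inv_mul_le_iff₀ hpos]
  linarith

lemma IsBody.gauge_add_le (hT : IsBody T) (v w : V) :
    gauge (polarBody T) (v + w) ≤ gauge (polarBody T) v + gauge (polarBody T) w :=
  _root_.gauge_add_le (convex_polarBody T) (absorbent_nhds_zero hT.polarBody_mem_nhds) v w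

lemma gauge_smul_nonneg (T : Set V) {a : ℝ} (ha : 0 ≤ a) (v : V) :
    gauge T (a • v) = a * gauge T v := by
  simpa using gauge_smul_of_nonneg (s := T) ha v

lemma IsBody.continuous_gauge (hT : IsBody T) : Continuous (gauge (polarBody T)) :=
  _root_.continuous_gauge (convex_polarBody T) hT.polarBody_mem_nhds

lemma IsBody.exists_pos_mul_norm_le (hT : IsBody T) :
    ∃ c > 0, ∀ v, c * ‖v‖ ≤ gauge (polarBody T) v := by
  obtain ⟨r, hr, hball⟩ := Metric.mem_nhds_iff.1 hT.mem_nhds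
  refine ⟨r / 2, by positivity, fun v ↦ ?_⟩
  rcases eq_or_ne v 0 with rfl | hv
  · simp
  have hv' : 0 < ‖v‖ := norm_pos_iff.2 hv
  have hy : (r / 2 / ‖v‖) • v ∈ T := by
    apply hball
    rw [mem_ball_zero_iff, norm_smul, Real.norm_of_nonneg (by positivity)]
    field_simp
    linarith
  refine le_trans (le_of_eq ?_) (hT.inner_le v hy)
  rw [inner_smul_right, real_inner_self_eq_norm_sq]
  field_simp

lemma IsBody.gauge_pos (hT : IsBody T) {v : V} (hv : v ≠ 0) : 0 < gauge (polarBody T) v := by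
  obtain ⟨c, hc, h⟩ := hT.exists_pos_mul_norm_le
  exact lt_of_lt_of_le (mul_pos hc (norm_pos_iff.2 hv)) (h v)

/-- Normality is the equality case of `IsBody.inner_le`; this is how billiard rules are read off
from equal sums. -/
lemma IsBody.mem_normalCone_iff (hT : IsBody T) {u z : V} (hz : z ∈ T) :
    u ∈ normalCone T z ↔ gauge (polarBody T) u = inner ℝ u z := by
  constructor
  · intro h
    obtain ⟨y, hy, hy'⟩ := hT.exists_gauge_eq u
    refine le_antisymm ?_ (hT.inner_le u hz)
    have := h y hy
    rw [inner_sub_right] at this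
    linarith
  · intro h y hy
    rw [inner_sub_right]
    linarith [hT.inner_le u hy]

lemma add_mem_normalCone {z u v : V} (hu : u ∈ normalCone T z) (hv : v ∈ normalCone T z) :
    u + v ∈ normalCone T z := fun y hy ↦ by
  rw [inner_add_left]
  linarith [hu y hy, hv y hy]

lemma smul_mem_normalCone {z u : V} {a : ℝ} (ha : 0 ≤ a) (hu : u ∈ normalCone T z) :
    a • u ∈ normalCone T z := fun y hy ↦ by
  rw [inner_smul_left]
  exact mul_nonpos_of_nonneg_of_nonpos (by simpa using ha) (hu y hy)

/-- A nonzero normal is strictly negative on directions into the interior. -/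
lemma inner_lt_of_mem_interior {z u y : V} (hu : u ∈ normalCone T z) (hu0 : u ≠ 0)
    (hy : y ∈ interior T) : inner ℝ u y < inner ℝ u z := by
  obtain ⟨r, hr, hball⟩ := Metric.mem_nhds_iff.1 (mem_interior_iff_mem_nhds.1 hy)
  have hu' : 0 < ‖u‖ := norm_pos_iff.2 hu0
  have hmem : y + (r / 2 / ‖u‖) • u ∈ T := by
    apply hball
    rw [mem_ball_iff_norm, add_sub_cancel_left, norm_smul, Real.norm_of_nonneg (by positivity)]
    field_simp
    linarith
  have := hu _ hmem
  rw [inner_sub_right, inner_add_right, inner_smul_right, real_inner_self_eq_norm_sq] at this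
  have hpos : 0 < r / 2 / ‖u‖ * ‖u‖ ^ 2 := by positivity
  linarith

lemma mem_frontier_of_normal {z u : V} (hz : z ∈ T) (hu : u ∈ normalCone T z) (hu0 : u ≠ 0) :
    z ∈ frontier T :=
  ⟨subset_closure hz, fun h ↦ lt_irrefl _ (inner_lt_of_mem_interior hu hu0 h)⟩

end Support

/-! ### Loops of points and duality for translation into a body -/

section Loops

variable {E : Type*} [NormedAddCommGroup E] [InnerProductSpace ℝ E]

/-- The `ℓ_T`-length of a closed loop of points, degenerate loops allowed. -/
def loopLength (T : Set E) {m : ℕ} [NeZero m] (w : Fin m → E) : ℝ :=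
  ∑ j, gauge (polarBody T) (w (j + 1) - w j)

/-- The family `w` cannot be translated into the interior of `K`. -/
def Untranslatable {E : Type*} [NormedAddCommGroup E] (K : Set E) {ι : Type*} (w : ι → E) : Prop :=
  ∀ v, ∃ j, w j + v ∉ interior K

lemma sum_cyclic_shift {M : Type*} [AddCommMonoid M] {m : ℕ} [NeZero m] (f : Fin m → M) :
    ∑ j, f (j + 1) = ∑ j, f j :=
  Equiv.sum_comp (Equiv.addRight (1 : Fin m)) f

/-- Cyclic summation by parts. -/
lemma sum_inner_cyclic {m : ℕ} [NeZero m] (p q : Fin m → E) :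
    ∑ j, inner ℝ (-(p (j + 1) - p j)) (q (j + 1)) = ∑ j, inner ℝ (p j) (q (j + 1) - q j) := by
  have h := sum_cyclic_shift fun j ↦ inner ℝ (p j) (q j)
  simp only [neg_sub, inner_sub_left, inner_sub_right, Finset.sum_sub_distrib]
  rw [h]

/-- A cyclic family with zero sum is a family of cyclic differences. -/
lemma exists_cyclic_primitive {E : Type*} [NormedAddCommGroup E] {m : ℕ} [NeZero m]
    (n : Fin m → E) (hn : ∑ j, n j = 0) :
    ∃ p : Fin m → E, ∀ j, p (j + 1) - p j = n j := by
  obtain ⟨k, rfl⟩ := Nat.exists_eq_succ_of_ne_zero (NeZero.ne m)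
  have hsum : ∀ j : Fin (k + 1), ∑ i ∈ Finset.range (j.val + 1), n (Fin.ofNat (k + 1) i) =
      ∑ i ∈ Finset.range j.val, n (Fin.ofNat (k + 1) i) + n j := fun j ↦ by
    rw [Finset.sum_range_succ]
    congr 2
    ext
    simp [Fin.ofNat, Nat.mod_eq_of_lt j.isLt]
  -- Partial sums over ℕ; the vanishing total makes them close up at the wrap-around index.
  set P : ℕ → E := fun t ↦ ∑ i ∈ Finset.range t, n (Fin.ofNat (k + 1) i) with hP
  have hend : P (k + 1) = 0 := by
    rw [← hn, hP]
    simp only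
    rw [← Fin.sum_univ_eq_sum_range (fun i ↦ n (Fin.ofNat (k + 1) i)) (k + 1)]
    refine Finset.sum_congr rfl fun i _ ↦ ?_
    congr 1
    ext
    simp [Fin.ofNat, Nat.mod_eq_of_lt i.isLt]
  refine ⟨fun j ↦ P j.val, fun j ↦ ?_⟩
  change P (j + 1).val - P j.val = n j
  rw [sub_eq_iff_eq_add']
  refine Eq.trans ?_ (hsum j)
  change P (j + 1).val = P (j.val + 1)
  induction j using Fin.lastCases with
  | last => rw [Fin.last_add_one, Fin.val_last, hend]; simp [hP]
  | cast j => rw [Fin.coeSucc_eq_succ, Fin.val_succ, Fin.val_castSucc]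

lemma exists_family_of_dual [FiniteDimensional ℝ E] {ι : Type*} [Fintype ι]
    (f : StrongDual ℝ (ι → E)) : ∃ n : ι → E, ∀ w, f w = ∑ j, inner ℝ (n j) (w j) := by
  classical
  refine ⟨fun j ↦ (InnerProductSpace.toDual ℝ E).symm
    (f.comp (ContinuousLinearMap.single ℝ (fun _ ↦ E) j)), fun w ↦ ?_⟩
  conv_lhs => rw [← Finset.univ_sum_single w, map_sum]
  simp

variable {K T : Set E}

/-- The sum is affine in v with slope ∑ n_j, so moving v along that vector would make it unbounded
below. -/
lemma sum_eq_zero_of_bddBelow {ι : Type*} [Fintype ι] {n w : ι → E} {u : ℝ}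
    (h : ∀ v, u ≤ ∑ j, inner ℝ (n j) (w j + v)) : ∑ j, n j = 0 := by
  by_contra hne
  set N := ∑ j, n j with hN
  have hpos : 0 < ‖N‖ ^ 2 := by have := norm_pos_iff.2 hne; positivity
  have h1 : ∀ s : ℝ, u ≤ ∑ j, inner ℝ (n j) (w j) + s * ‖N‖ ^ 2 := fun s ↦ by
    have := h (s • N)
    simp only [inner_add_right, Finset.sum_add_distrib] at this
    rwa [← sum_inner, ← hN, inner_smul_right, real_inner_self_eq_norm_sq] at this
  have h2 := h1 ((u - 1 - ∑ j, inner ℝ (n j) (w j)) / ‖N‖ ^ 2)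
  rw [div_mul_cancel₀ _ hpos.ne'] at h2
  linarith

/-- Hahn–Banach in the product space: the interior of the power of K misses the affine space of
translates of w. A functional bounded below on that space has components summing to zero. -/
lemma Untranslatable.exists_normals [FiniteDimensional ℝ E] {ι : Type*} [Fintype ι]
    (hK : IsBody K) {w : ι → E}
    (h : Untranslatable K w) :
    ∃ n : ι → E, n ≠ 0 ∧ ∑ j, n j = 0 ∧
      ∀ k : ι → E, (∀ j, k j ∈ K) → ∑ j, inner ℝ (n j) (k j) ≤ ∑ j, inner ℝ (n j) (w j) := by
  have hint : interior (univ.pi fun _ : ι ↦ K) = univ.pi fun _ ↦ interior K :=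
    interior_pi_set finite_univ
  have hconv : Convex ℝ (univ.pi fun _ : ι ↦ K) := convex_pi fun _ _ ↦ hK.convex
  have hdis : Disjoint (interior (univ.pi fun _ : ι ↦ K)) (range fun v j ↦ w j + v) := by
    rw [disjoint_left]
    rintro _ hk ⟨v, rfl⟩
    obtain ⟨j, hj⟩ := h v
    rw [hint] at hk
    exact hj (hk j trivial)
  have hconv' : Convex ℝ (range fun (v : E) (j : ι) ↦ w j + v) := by
    rintro _ ⟨v, rfl⟩ _ ⟨v', rfl⟩ a b _ _ hab
    refine ⟨a • v + b • v', funext fun j ↦ ?_⟩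
    simp only [Pi.add_apply, Pi.smul_apply]
    calc w j + (a • v + b • v') = (a + b) • w j + (a • v + b • v') := by rw [hab, one_smul]
      _ = _ := by module
  obtain ⟨f, u, hf0, hf1, hf2⟩ := geometric_hahn_banach_of_nonempty_interior hconv hconv'
    hdis ⟨0, by rw [hint]; exact fun _ _ ↦ hK.zero_mem_interior⟩ (range_nonempty _)
  obtain ⟨n, hn⟩ := exists_family_of_dual f
  refine ⟨n, ?_, ?_, fun k hk ↦ ?_⟩
  · rintro rfl
    exact hf0 (by ext w; simp [hn])
  · refine sum_eq_zero_of_bddBelow (w := w) (u := u) fun v ↦ ?_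
    rw [← hn fun j ↦ w j + v]
    exact hf2 _ ⟨v, rfl⟩
  · rw [← hn, ← hn]
    exact (hf1 k fun j _ ↦ hk j).trans (hf2 w ⟨0, by simp⟩)

/-- A family of normals with zero sum obstructs translation into the interior. -/
lemma untranslatable_of_normals {ι : Type*} [Fintype ι] {w n k : ι → E}
    (hn0 : n ≠ 0) (hn : ∑ j, n j = 0) (hnk : ∀ j, n j ∈ normalCone K (k j))
    (h : ∑ j, inner ℝ (n j) (k j) ≤ ∑ j, inner ℝ (n j) (w j)) : Untranslatable K w := by
  intro v
  by_contra! hv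
  obtain ⟨i, hi⟩ := Function.ne_iff.1 hn0
  have hlt : ∑ j, inner ℝ (n j) (w j + v) < ∑ j, inner ℝ (n j) (k j) := by
    refine Finset.sum_lt_sum (fun j _ ↦ ?_) ⟨i, Finset.mem_univ _, ?_⟩
    · have := hnk j _ (interior_subset (hv j))
      rw [inner_sub_right] at this
      linarith
    · exact inner_lt_of_mem_interior (hnk i) hi (hv i)
  simp only [inner_add_right, Finset.sum_add_distrib] at hlt
  rw [← sum_inner, hn, inner_zero_left] at hlt
  linarith

/-- Criterion for a family to be translatable into a compact convex set. -/
lemma exists_translate_mem [FiniteDimensional ℝ E] {ι : Type*} [Fintype ι]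
    (hK : IsBody K) {w : ι → E}
    (h : ∀ n : ι → E, ∑ j, n j = 0 →
      ∑ j, inner ℝ (n j) (w j) ≤ ∑ j, gauge (polarBody K) (n j)) :
    ∃ v, ∀ j, w j + v ∈ K := by
  by_contra! hcon
  -- The translates of w are described by equations, so that closedness is immediate and strict
  -- separation from the compact power of K applies.
  have hdis : Disjoint (univ.pi fun _ : ι ↦ K) {a | ∀ i j, a i - w i = a j - w j} := by
    rw [disjoint_left]
    intro k hk hk'
    rcases isEmpty_or_nonempty ι with hι | ⟨⟨i⟩⟩
    · obtain ⟨j, -⟩ := hcon 0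
      exact hι.elim j
    · obtain ⟨j, hj⟩ := hcon (k i - w i)
      rw [hk' i j, add_sub_cancel] at hj
      exact hj (hk j trivial)
  have hclosed : IsClosed {a : ι → E | ∀ i j, a i - w i = a j - w j} := by
    simp only [ofPred_forall]
    exact isClosed_iInter fun i ↦ isClosed_iInter fun j ↦
      isClosed_eq (by fun_prop) (by fun_prop)
  have hconv : Convex ℝ {a : ι → E | ∀ i j, a i - w i = a j - w j} := by
    intro a ha b hb s t _ _ hst i j
    have h1 := ha i j
    have h2 := hb i j
    simp only [Pi.add_apply, Pi.smul_apply]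
    calc s • a i + t • b i - w i = s • a i + t • b i - (s + t) • w i := by rw [hst, one_smul]
      _ = s • (a i - w i) + t • (b i - w i) := by module
      _ = s • a j + t • b j - (s + t) • w j := by rw [h1, h2]; module
      _ = _ := by rw [hst, one_smul]
  obtain ⟨f, u, u', hf1, huu, hf2⟩ := geometric_hahn_banach_compact_closed
    (convex_pi fun _ _ ↦ hK.convex) (isCompact_univ_pi fun _ ↦ hK.isCompact) hconv hclosed hdis
  obtain ⟨n, hn⟩ := exists_family_of_dual f
  have hmem : ∀ v, (fun j ↦ w j + v) ∈ {a : ι → E | ∀ i j, a i - w i = a j - w j} :=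
    fun v i j ↦ by simp
  have hsum : ∑ j, n j = 0 := by
    refine sum_eq_zero_of_bddBelow (w := w) (u := u') fun v ↦ ?_
    rw [← hn fun j ↦ w j + v]
    exact (hf2 _ (hmem v)).le
  choose k hk hk' using fun j ↦ hK.exists_gauge_eq (n j)
  have h1 := hf1 k fun j _ ↦ hk j
  have h2 := hf2 w (by simp)
  have h3 := h n hsum
  rw [hn] at h1 h2
  simp only [hk'] at h3
  linarith

end Loops

/-! ### Existence of a shortest untranslatable loop and its billiard structure -/

section Minimizers

variable {E : Type*} [NormedAddCommGroup E] [InnerProductSpace ℝ E] {K T : Set E}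

lemma loopLength_nonneg (T : Set E) {m : ℕ} [NeZero m] (w : Fin m → E) : 0 ≤ loopLength T w :=
  Finset.sum_nonneg fun _ _ ↦ gauge_nonneg _

lemma loopLength_smul (T : Set E) {m : ℕ} [NeZero m] {a : ℝ} (ha : 0 ≤ a) (w : Fin m → E) :
    loopLength T (a • w) = a * loopLength T w := by
  simp only [loopLength, Finset.mul_sum, Pi.smul_apply, ← smul_sub, gauge_smul_nonneg _ ha]

lemma loopLength_add_const (T : Set E) {m : ℕ} [NeZero m] (w : Fin m → E) (v : E) :
    loopLength T (fun j ↦ w j + v) = loopLength T w := by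
  simp [loopLength]

lemma Untranslatable.add_const {E : Type*} [NormedAddCommGroup E] {K : Set E} {ι : Type*}
    {w : ι → E} (h : Untranslatable K w) (v : E) :
    Untranslatable K (fun j ↦ w j + v) := fun u ↦ by
  simpa [add_assoc] using h (v + u)

lemma isClosed_untranslatable {E : Type*} [NormedAddCommGroup E] {ι : Type*} [Finite ι]
    (K : Set E) :
    IsClosed {w : ι → E | Untranslatable K w} := by
  simp only [Untranslatable, ofPred_forall, ofPred_exists]
  exact isClosed_iInter fun v ↦ isClosed_iUnion_of_finite fun j ↦
    isOpen_interior.isClosed_compl.preimage ((continuous_apply j).add continuous_const)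

lemma IsBody.exists_norm_sub_le (hT : IsBody T) (m : ℕ) [NeZero m] :
    ∃ C, ∀ w : Fin m → E, ∀ j, ‖w j - w 0‖ ≤ C * loopLength T w := by
  obtain ⟨k, rfl⟩ := Nat.exists_eq_succ_of_ne_zero (NeZero.ne m)
  obtain ⟨c, hc, h⟩ := hT.exists_pos_mul_norm_le
  have hedge : ∀ (w : Fin (k + 1) → E) (j), ‖w (j + 1) - w j‖ ≤ c⁻¹ * loopLength T w := by
    intro w j
    rw [le_inv_mul_iff₀ hc]
    exact (h _).trans (Finset.single_le_sum (f := fun j ↦ gauge (polarBody T) (w (j + 1) - w j))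
      (fun _ _ ↦ gauge_nonneg _) (Finset.mem_univ j))
  have hind : ∀ (w : Fin (k + 1) → E) (j : Fin (k + 1)),
      ‖w j - w 0‖ ≤ j.val * (c⁻¹ * loopLength T w) := by
    intro w j
    induction j using Fin.induction with
    | zero => simp
    | succ j ih =>
      have h1 := hedge w j.castSucc
      rw [Fin.coeSucc_eq_succ] at h1
      have h2 := norm_add_le (w j.succ - w j.castSucc) (w j.castSucc - w 0)
      rw [sub_add_sub_cancel] at h2
      rw [Fin.val_castSucc] at ih
      rw [Fin.val_succ]
      push_cast
      linarith
  refine ⟨(k + 1) * c⁻¹, fun w j ↦ (hind w j).trans ?_⟩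
  have := loopLength_nonneg T w
  rw [mul_assoc]
  gcongr
  exact_mod_cast j.isLt.le

lemma Untranslatable.loopLength_pos (hK : IsBody K) (hT : IsBody T) {m : ℕ} [NeZero m]
    {w : Fin m → E} (h : Untranslatable K w) : 0 < loopLength T w := by
  refine (loopLength_nonneg T w).lt_of_ne' fun h0 ↦ ?_
  obtain ⟨C, hC⟩ := hT.exists_norm_sub_le m
  obtain ⟨j, hj⟩ := h (-w 0)
  have h1 := hC w j
  rw [h0, mul_zero, norm_le_zero_iff, sub_eq_add_neg] at h1
  rw [h1] at hj
  exact hj hK.zero_mem_interior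

lemma exists_untranslatable [Nontrivial E] (hK : IsBody K) {m : ℕ} [NeZero m] (hm : 2 ≤ m) :
    ∃ w : Fin m → E, Untranslatable K w := by
  obtain ⟨R, hR⟩ := hK.isCompact.isBounded.exists_norm_le
  -- Two points farther apart than 2R, a bound for the diameter of K, fit in no translate.
  obtain ⟨e, he⟩ := NormedSpace.exists_lt_norm ℝ E (2 * R)
  refine ⟨fun j ↦ if j = 0 then 0 else e, fun v ↦ ?_⟩
  by_contra! hcon
  have h0 := hR _ (interior_subset (hcon 0))
  have h1 := hR _ (interior_subset (hcon ⟨1, hm⟩))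
  have hne : (⟨1, hm⟩ : Fin m) ≠ 0 := by simp [Fin.ext_iff]
  simp only [if_true, if_neg hne, zero_add] at h0 h1
  have := norm_sub_le (e + v) v
  rw [add_sub_cancel_right] at this
  linarith

/-- Among loops that cannot be translated into the interior of `K`, one has minimal length. -/
lemma exists_minimal_loop [FiniteDimensional ℝ E] [Nontrivial E] (hK : IsBody K) (hT : IsBody T)
    {m : ℕ} [NeZero m] (hm : 2 ≤ m) :
    ∃ w : Fin m → E, Untranslatable K w ∧
      ∀ w' : Fin m → E, Untranslatable K w' → loopLength T w ≤ loopLength T w' := by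
  obtain ⟨w₁, hw₁⟩ := exists_untranslatable hK hm
  obtain ⟨C, hC⟩ := hT.exists_norm_sub_le m
  have hcont : Continuous fun w : Fin m → E ↦ loopLength T w :=
    continuous_finsetSum _ fun j _ ↦ hT.continuous_gauge.comp (by fun_prop)
  -- Normalizing the first vertex to 0 removes the translation freedom, and the length bound then
  -- makes the set compact.
  set S := {w : Fin m → E | Untranslatable K w} ∩
    ({w | w 0 = 0} ∩ {w | loopLength T w ≤ loopLength T w₁}) with hS
  have hclosed : IsClosed S := (isClosed_untranslatable K).inter
    ((isClosed_eq (continuous_apply 0) continuous_const).inter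
      (isClosed_le hcont continuous_const))
  have hbdd : Bornology.IsBounded S := by
    refine isBounded_iff_forall_norm_le.2 ⟨|C| * loopLength T w₁, fun w hw ↦ ?_⟩
    refine (pi_norm_le_iff_of_nonneg
      (mul_nonneg (abs_nonneg C) (loopLength_nonneg T w₁))).2 fun j ↦ ?_
    have h1 := hC w j
    rw [hw.2.1, sub_zero] at h1
    refine h1.trans (mul_le_mul (le_abs_self C) hw.2.2 (loopLength_nonneg T w) (abs_nonneg C))
  have hnorm : ∀ w : Fin m → E, Untranslatable K w → loopLength T w ≤ loopLength T w₁ →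
      (fun j ↦ w j + -w 0) ∈ S := fun w hw hle ↦
    ⟨hw.add_const _, by simp, by simpa [loopLength_add_const] using hle⟩
  obtain ⟨w, hwS, hmin⟩ := (Metric.isCompact_of_isClosed_isBounded hclosed hbdd).exists_isMinOn
    ⟨_, hnorm w₁ hw₁ le_rfl⟩ hcont.continuousOn
  refine ⟨w, hwS.1, fun w' hw' ↦ ?_⟩
  rcases le_total (loopLength T w') (loopLength T w₁) with hle | hle
  · have := hmin (hnorm w' hw' hle)
    simpa [loopLength_add_const] using this
  · exact le_trans hwS.2.2 hle

/-- A strong billiard trajectory without the non-degeneracy requirements. -/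
structure IsWeakBilliard (K T : Set E) {m : ℕ} [NeZero m] (q p : Fin m → E) : Prop where
  q_mem : ∀ j, q j ∈ K
  p_mem : ∀ j, p j ∈ T
  edge : ∀ j, q (j + 1) - q j ∈ normalCone T (p j)
  bounce : ∀ j, -(p (j + 1) - p j) ∈ normalCone K (q (j + 1))

namespace IsWeakBilliard

variable {m : ℕ} [NeZero m] {q p : Fin m → E}

lemma loopLength_eq (h : IsWeakBilliard K T q p) (hT : IsBody T) :
    loopLength T q = ∑ j, inner ℝ (p j) (q (j + 1) - q j) :=
  Finset.sum_congr rfl fun j _ ↦ by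
    rw [real_inner_comm]
    exact (hT.mem_normalCone_iff (h.p_mem j)).1 (h.edge j)

lemma sum_bounce_eq (h : IsWeakBilliard K T q p) (hK : IsBody K) (hT : IsBody T) :
    ∑ j, gauge (polarBody K) (-(p (j + 1) - p j)) = loopLength T q := by
  rw [h.loopLength_eq hT, ← sum_inner_cyclic]
  exact Finset.sum_congr rfl fun j _ ↦ (hK.mem_normalCone_iff (h.q_mem _)).1 (h.bounce j)

/-- The bounce normals telescope to zero and are attained at the vertices; positive length prevents
them from all vanishing. -/
lemma untranslatable_q (h : IsWeakBilliard K T q p) (hK : IsBody K) (hT : IsBody T)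
    (hpos : 0 < loopLength T q) : Untranslatable K q := by
  have key : Untranslatable K fun j ↦ q (j + 1) := by
    refine untranslatable_of_normals (n := fun j ↦ -(p (j + 1) - p j)) (fun h0 ↦ ?_) ?_ h.bounce
      le_rfl
    · rw [← h.sum_bounce_eq hK hT] at hpos
      refine hpos.ne' (Finset.sum_eq_zero fun j _ ↦ ?_)
      rw [congrFun h0 j, Pi.zero_apply, gauge_zero]
    · rw [Finset.sum_neg_distrib, Finset.sum_sub_distrib, sum_cyclic_shift, sub_self, neg_zero]
  intro v
  obtain ⟨j, hj⟩ := key v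
  exact ⟨_, hj⟩

lemma untranslatable_p (h : IsWeakBilliard K T q p) (hpos : 0 < loopLength T q) :
    Untranslatable T p := by
  refine untranslatable_of_normals (n := fun j ↦ q (j + 1) - q j) (fun h0 ↦ ?_) ?_ h.edge le_rfl
  · refine hpos.ne' (Finset.sum_eq_zero fun j _ ↦ ?_)
    rw [show q (j + 1) - q j = 0 from congrFun h0 j, gauge_zero]
  · rw [Finset.sum_sub_distrib, sum_cyclic_shift, sub_self]

/-- The reversed `p`-loop has the same length and cannot be translated into the interior
of `T`. -/
lemma exists_dual_loop (h : IsWeakBilliard K T q p) (hK : IsBody K) (hT : IsBody T)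
    (hpos : 0 < loopLength T q) :
    ∃ w : Fin m → E, Untranslatable T w ∧ loopLength K w = loopLength T q := by
  refine ⟨fun j ↦ p (-j), fun v ↦ ?_, ?_⟩
  · obtain ⟨j, hj⟩ := h.untranslatable_p hpos v
    exact ⟨-j, by simpa using hj⟩
  · rw [← h.sum_bounce_eq hK hT, loopLength]
    -- Under j ↦ -1 - j the edges of the reversed loop become -(p_{j+1} - p_j); the sign matters
    -- because K need not be symmetric.
    rw [← Equiv.sum_comp (Equiv.subLeft (-1 : Fin m))]
    refine Finset.sum_congr rfl fun j _ ↦ ?_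
    simp only [Equiv.subLeft_apply]
    congr 2
    rw [show -(-1 - j + 1) = j by abel, show -(-1 - j) = j + 1 by abel]
    abel

end IsWeakBilliard

lemma eq_of_sum_eq {ι : Type*} [Fintype ι] {f g : ι → ℝ} (hle : ∀ i, f i ≤ g i)
    (hsum : ∑ i, g i ≤ ∑ i, f i) (i : ι) : f i = g i :=
  (Finset.sum_eq_sum_iff_of_le fun i _ ↦ hle i).1
    (le_antisymm (Finset.sum_le_sum fun i _ ↦ hle i) hsum) i (Finset.mem_univ i)

/-- A loop of minimal length is, up to translation, a billiard trajectory. -/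
lemma exists_weakBilliard_of_minimal [FiniteDimensional ℝ E] (hK : IsBody K) (hT : IsBody T)
    {m : ℕ} [NeZero m] {w : Fin m → E} (hw : Untranslatable K w)
    (hmin : ∀ w' : Fin m → E, Untranslatable K w' → loopLength T w ≤ loopLength T w') :
    ∃ q p : Fin m → E, IsWeakBilliard K T q p ∧ loopLength T q = loopLength T w := by
  have hL := hw.loopLength_pos hK hT
  set L := loopLength T w with hLdef
  have hfeas : ∀ n w' : Fin m → E, n ≠ 0 → ∑ j, n j = 0 →
      ∑ j, gauge (polarBody K) (n j) ≤ ∑ j, inner ℝ (n j) (w' j) → L ≤ loopLength T w' := by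
    intro n w' hn0 hn hle
    choose k hk hk' using fun j ↦ hK.exists_gauge_eq (n j)
    refine hmin _ (untranslatable_of_normals hn0 hn
      (fun j ↦ (hK.mem_normalCone_iff (hk j)).2 (hk' j)) ?_)
    simpa only [hk'] using hle
  have hgpos : ∀ n : Fin m → E, n ≠ 0 → 0 < ∑ j, gauge (polarBody K) (n j) := by
    intro n hn0
    obtain ⟨i, hi⟩ := Function.ne_iff.1 hn0
    exact Finset.sum_pos' (fun _ _ ↦ gauge_nonneg _) ⟨i, Finset.mem_univ _, hK.gauge_pos hi⟩
  -- If s = ∑ ⟨n_j, w'_j⟩ is positive, n certifies that (c/s) w' is untranslatable, so its length is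
  -- at least L.
  have hscale : ∀ n w' : Fin m → E, n ≠ 0 → ∑ j, n j = 0 →
      L * ∑ j, inner ℝ (n j) (w' j) ≤ (∑ j, gauge (polarBody K) (n j)) * loopLength T w' := by
    intro n w' hn0 hn
    have hc := hgpos n hn0
    set c := ∑ j, gauge (polarBody K) (n j) with hcdef
    set s := ∑ j, inner ℝ (n j) (w' j) with hs
    rcases le_or_gt s 0 with hs0 | hs0
    · exact (mul_nonpos_of_nonneg_of_nonpos hL.le hs0).trans
        (mul_nonneg hc.le (loopLength_nonneg T w'))
    · have := hfeas n ((c / s) • w') hn0 hn (by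
        simp only [Pi.smul_apply, inner_smul_right, ← Finset.mul_sum]
        rw [← hs, div_mul_cancel₀ _ hs0.ne'])
      rw [loopLength_smul _ (by positivity), div_mul_eq_mul_div, le_div_iff₀ hs0] at this
      exact this
  obtain ⟨n, hn0, hn, hnk⟩ := hw.exists_normals hK
  set c := ∑ j, gauge (polarBody K) (n j) with hcdef
  have hc : 0 < c := hgpos n hn0
  have hcw : ∑ j, inner ℝ (n j) (w j) = c := by
    refine le_antisymm ?_ ?_
    · have := hscale n w hn0 hn
      rw [← hLdef, mul_comm] at this
      exact le_of_mul_le_mul_right this hL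
    · choose k hk hk' using fun j ↦ hK.exists_gauge_eq (n j)
      rw [hcdef]
      simpa only [hk'] using hnk k hk
  obtain ⟨v, hv⟩ := exists_translate_mem hK (w := w) fun n' hn' ↦ by
    rcases eq_or_ne n' 0 with rfl | hn'0
    · simp
    · have := hscale n' w hn'0 hn'
      rw [← hLdef, mul_comm] at this
      exact le_of_mul_le_mul_right this hL
  -- Summation by parts turns the pairing of n with vertices into a pairing of p₀ with edges.
  obtain ⟨p₀, hp₀⟩ := exists_cyclic_primitive (fun j ↦ -n (j + 1)) (by
    rw [Finset.sum_neg_distrib, sum_cyclic_shift, hn, neg_zero])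
  have hsum : ∀ w' : Fin m → E,
      ∑ j, inner ℝ (p₀ j) (w' (j + 1) - w' j) = ∑ j, inner ℝ (n j) (w' j) := fun w' ↦ by
    rw [← sum_inner_cyclic, ← sum_cyclic_shift fun j ↦ inner ℝ (n j) (w' j)]
    simp only [hp₀, neg_neg]
  -- Every zero-sum family is the edge family of some loop w', so the scaling inequality is the
  -- translation criterion for T. The factor L/c normalizes the total pairing of p with the edges of
  -- w to L.
  obtain ⟨u, hu⟩ := exists_translate_mem hT (w := (L / c) • p₀) fun n' hn' ↦ by
    obtain ⟨w', hw'⟩ := exists_cyclic_primitive n' hn'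
    have h1 := hscale n w' hn0 hn
    have h2 := hsum w'
    simp only [hw'] at h2
    simp only [Pi.smul_apply, inner_smul_right, ← Finset.mul_sum, real_inner_comm (p₀ _)]
    rw [← h2, mul_comm c] at h1
    rw [div_mul_eq_mul_div, div_le_iff₀ hc]
    simpa only [loopLength, hw'] using h1
  set q : Fin m → E := fun j ↦ w j + v with hq
  set p : Fin m → E := fun j ↦ ((L / c) • p₀) j + u with hp
  have hlen : loopLength T q = L := loopLength_add_const T w v
  have hedge : ∀ j, inner ℝ (q (j + 1) - q j) (p j) =
      gauge (polarBody T) (q (j + 1) - q j) := by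
    refine eq_of_sum_eq (fun j ↦ hT.inner_le _ (hu j)) ?_
    have h1 : ∑ j, inner ℝ (q (j + 1) - q j) (p j) = L := by
      have h2 := hsum w
      rw [hcw] at h2
      have h3 : ∑ j, inner ℝ (q (j + 1) - q j) u = 0 := by
        rw [← sum_inner, Finset.sum_sub_distrib, sum_cyclic_shift, sub_self, inner_zero_left]
      simp only [hp, inner_add_right, Finset.sum_add_distrib, h3, Pi.smul_apply,
        inner_smul_right, ← Finset.mul_sum]
      simp only [hq, add_sub_add_right_eq_sub, real_inner_comm (p₀ _), h2]
      field_simp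
      ring
    rw [h1]
    exact hlen.le
  have hbounce : ∀ j, inner ℝ (n j) (q j) = gauge (polarBody K) (n j) := by
    refine eq_of_sum_eq (fun j ↦ hK.inner_le _ (hv j)) ?_
    simp only [hq, inner_add_right, Finset.sum_add_distrib]
    rw [hcw, ← sum_inner, hn, inner_zero_left, add_zero]
  refine ⟨q, p, ⟨hv, hu, fun j ↦ (hT.mem_normalCone_iff (hu j)).2 (hedge j).symm, fun j ↦ ?_⟩,
    hlen⟩
  have : -(p (j + 1) - p j) = (L / c) • n (j + 1) := by
    simp only [hp, add_sub_add_right_eq_sub, Pi.smul_apply, ← smul_sub, hp₀, smul_neg, neg_neg]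
  rw [this]
  exact smul_mem_normalCone (by positivity)
    ((hK.mem_normalCone_iff (hv _)).2 (hbounce (j + 1)).symm)

end Minimizers

/-! ### Removing degenerate vertices, and padding polygons to n+1 points -/

section Reduction

variable {E : Type*} [NormedAddCommGroup E] [InnerProductSpace ℝ E] {K T : Set E}

lemma loopLength_succ (T : Set E) {k : ℕ} (w : Fin (k + 1) → E) :
    loopLength T w = ∑ i : Fin k, gauge (polarBody T) (w i.succ - w i.castSucc) +
      gauge (polarBody T) (w 0 - w (Fin.last k)) := by
  rw [loopLength, Fin.sum_univ_castSucc, Fin.last_add_one]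
  simp only [Fin.coeSucc_eq_succ]

/-- The length of a loop in terms of the loop with its last vertex deleted. -/
lemma loopLength_castSucc (T : Set E) {k : ℕ} (w : Fin (k + 2) → E) :
    loopLength T w + gauge (polarBody T) (w 0 - w (Fin.last k).castSucc) =
      loopLength T (fun j : Fin (k + 1) ↦ w j.castSucc) +
        gauge (polarBody T) (w (Fin.last (k + 1)) - w (Fin.last k).castSucc) +
        gauge (polarBody T) (w 0 - w (Fin.last (k + 1))) := by
  rw [loopLength_succ, loopLength_succ, Fin.sum_univ_castSucc]
  simp only [Fin.succ_castSucc, Fin.succ_last, Fin.castSucc_zero]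
  ring

namespace IsWeakBilliard

lemma rotate {m : ℕ} [NeZero m] {q p : Fin m → E} (h : IsWeakBilliard K T q p) (a : Fin m) :
    IsWeakBilliard K T (fun j ↦ q (j + a)) (fun j ↦ p (j + a)) where
  q_mem j := h.q_mem _
  p_mem j := h.p_mem _
  edge j := by simpa [add_right_comm] using h.edge (j + a)
  bounce j := by simpa [add_right_comm] using h.bounce (j + a)

end IsWeakBilliard

lemma loopLength_rotate (T : Set E) {m : ℕ} [NeZero m] (w : Fin m → E) (a : Fin m) :
    loopLength T (fun j ↦ w (j + a)) = loopLength T w := by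
  refine Eq.trans (Finset.sum_congr rfl fun j _ ↦ ?_)
    (Equiv.sum_comp (Equiv.addRight a) fun j ↦ gauge (polarBody T) (w (j + 1) - w j))
  simp [add_right_comm]

namespace IsWeakBilliard

variable {k : ℕ} {q p : Fin (k + 2) → E}

/-- The last vertex can be deleted if the conditions across the gap persist. -/
lemma castSucc (h : IsWeakBilliard K T q p)
    (hedge : q 0 - q (Fin.last k).castSucc ∈ normalCone T (p (Fin.last k).castSucc))
    (hbounce : -(p 0 - p (Fin.last k).castSucc) ∈ normalCone K (q 0)) :
    IsWeakBilliard K T (fun j : Fin (k + 1) ↦ q j.castSucc) (fun j ↦ p j.castSucc) where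
  q_mem j := h.q_mem _
  p_mem j := h.p_mem _
  edge j := by
    induction j using Fin.lastCases with
    | last => simpa using hedge
    | cast j => simpa [Fin.coeSucc_eq_succ, ← Fin.succ_castSucc] using h.edge j.castSucc.castSucc
  bounce j := by
    induction j using Fin.lastCases with
    | last => simpa using hbounce
    | cast j =>
      simpa [Fin.coeSucc_eq_succ, ← Fin.succ_castSucc] using h.bounce j.castSucc.castSucc

/-- A weak billiard trajectory that is degenerate at its last vertex can be shortened. -/
lemma exists_shorter (h : IsWeakBilliard K T q p) (hT : IsBody T)
    (hdeg : q 0 = q (Fin.last (k + 1)) ∨ p (Fin.last (k + 1)) = p (Fin.last k).castSucc ∨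
      q (Fin.last (k + 1)) ≠ q (Fin.last k).castSucc ∧
        q (Fin.last (k + 1)) ∈ segment ℝ (q (Fin.last k).castSucc) (q 0)) :
    ∃ q' p' : Fin (k + 1) → E, IsWeakBilliard K T q' p' ∧ loopLength T q' = loopLength T q := by
  have hlen := loopLength_castSucc T q
  have e0 : (Fin.last k).castSucc + 1 = Fin.last (k + 1) := by
    rw [Fin.coeSucc_eq_succ, Fin.succ_last]
  have h1 := h.edge (Fin.last k).castSucc
  have h2 := h.edge (Fin.last (k + 1))
  have h3 := h.bounce (Fin.last k).castSucc
  have h4 := h.bounce (Fin.last (k + 1))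
  rw [e0] at h1 h3
  rw [Fin.last_add_one] at h2 h4
  have hpl := h.p_mem (Fin.last k).castSucc
  have hpl' := h.p_mem (Fin.last (k + 1))
  have hql' := h.q_mem (Fin.last k).castSucc
  have hq0 := h.q_mem 0
  suffices hs : q 0 - q (Fin.last k).castSucc ∈ normalCone T (p (Fin.last k).castSucc) ∧
      -(p 0 - p (Fin.last k).castSucc) ∈ normalCone K (q 0) ∧
      gauge (polarBody T) (q 0 - q (Fin.last k).castSucc) =
        gauge (polarBody T) (q (Fin.last (k + 1)) - q (Fin.last k).castSucc) +
        gauge (polarBody T) (q 0 - q (Fin.last (k + 1))) from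
    ⟨_, _, h.castSucc hs.1 hs.2.1, by linarith [hs.2.2]⟩
  generalize q 0 = q₀ at *
  generalize q (Fin.last (k + 1)) = q₂ at *
  generalize q (Fin.last k).castSucc = q₁ at *
  generalize p 0 = p₀ at *
  generalize p (Fin.last (k + 1)) = p₂ at *
  generalize p (Fin.last k).castSucc = p₁ at *
  have hp : -(p₀ - p₁) = -(p₀ - p₂) + -(p₂ - p₁) := by abel
  have hq : q₀ - q₁ = (q₂ - q₁) + (q₀ - q₂) := by abel
  rcases hdeg with rfl | rfl | ⟨hne, a, b, ha, hb, hab, hseg⟩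
  · exact ⟨h1, hp ▸ add_mem_normalCone h4 h3, by simp⟩
  · have h5 := add_mem_normalCone h1 h2
    refine ⟨hq ▸ h5, h4, ?_⟩
    rw [(hT.mem_normalCone_iff hpl).1 h1, (hT.mem_normalCone_iff hpl).1 h2, hq,
      (hT.mem_normalCone_iff hpl).1 h5, inner_add_left]
  · obtain rfl : a = 1 - b := by linarith
    have e1 : q₂ - q₁ = b • (q₀ - q₁) := by rw [← hseg]; module
    have e2 : q₀ - q₂ = (1 - b) • (q₀ - q₁) := by rw [← hseg]; module
    -- Only here is q₂ ≠ q₁ used: it allows rescaling the normal q₂ - q₁ to q₀ - q₁.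
    have hb0 : 0 < b := by
      refine hb.lt_of_ne' ?_
      rintro rfl
      rw [zero_smul, sub_eq_zero] at e1
      exact hne e1
    refine ⟨?_, ?_, ?_⟩
    · have := smul_mem_normalCone (inv_nonneg.2 hb) h1
      rwa [e1, inv_smul_smul₀ hb0.ne'] at this
    · rw [hp]
      -- The jump p₁ - p₂ attains its maximum over K at q₂. Testing at q₁ shows that it does not
      -- decrease towards q₀, so it is also normal at q₀.
      refine add_mem_normalCone h4 fun y hy ↦ ?_
      have h5 := h3 y hy
      have h6 := h3 q₁ hql'
      have h7 := h3 q₀ hq0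
      generalize -(p₂ - p₁) = n at *
      rw [e2, inner_smul_right] at h7
      rw [← neg_sub q₂, e1, inner_neg_right, inner_smul_right] at h6
      have h8 : 0 ≤ inner ℝ n (q₀ - q₁) := by
        by_contra! hneg
        nlinarith
      have h9 : y - q₀ = (y - q₂) - (1 - b) • (q₀ - q₁) := by rw [← e2]; abel
      rw [h9, inner_sub_right, inner_smul_right]
      nlinarith
    · rw [e1, e2, gauge_smul_nonneg _ hb, gauge_smul_nonneg _ ha]
      ring

end IsWeakBilliard

/-- Every weak billiard trajectory of positive length reduces to a strong one. -/
lemma IsWeakBilliard.exists_strong (hT : IsBody T) {k : ℕ} {q p : Fin (k + 1) → E}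
    (h : IsWeakBilliard K T q p) (hpos : 0 < loopLength T q) :
    ∃ r : ClosedPolygon E, r ∈ M (k + 1) K T ∧ length T r = loopLength T q := by
  induction k with
  | zero =>
    simp [loopLength, Subsingleton.elim _ (0 : Fin 1)] at hpos
  | succ k ih =>
    by_cases hdeg : ∃ j, q (j + 1) = q j ∨ p j = p (j - 1) ∨
        q j ≠ q (j - 1) ∧ q j ∈ segment ℝ (q (j - 1)) (q (j + 1))
    · obtain ⟨j, hj⟩ := hdeg
      -- Rotate so that the degenerate vertex comes last.
      have e1 : Fin.last (k + 1) + (j - Fin.last (k + 1)) = j := by abel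
      have e2 : 0 + (j - Fin.last (k + 1)) = j + 1 := by
        rw [← Fin.last_add_one (k + 1)]; abel
      have e3 : (Fin.last k).castSucc + (j - Fin.last (k + 1)) = j - 1 := by
        rw [← Fin.succ_last, ← Fin.coeSucc_eq_succ]; abel
      obtain ⟨q', p', h', hlen⟩ := (h.rotate (j - Fin.last (k + 1))).exists_shorter hT
        (by simpa only [e1, e2, e3] using hj)
      rw [loopLength_rotate] at hlen
      obtain ⟨r, hr, hr'⟩ := ih h' (hlen ▸ hpos)
      exact ⟨r, ⟨hr.1.trans (Nat.le_succ _), hr.2⟩, hr'.trans hlen⟩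
    · push Not at hdeg
      have hne : ∀ j, q j ≠ q (j + 1) := fun j ↦ (hdeg j).1.symm
      refine ⟨⟨k + 2, by omega, q, hne, fun j ↦ (hdeg j).2.2 ?_⟩, ⟨le_rfl, fun j ↦ ?_, p,
        fun j ↦ ?_, fun j ↦ ⟨h.edge j, h.bounce j⟩⟩, rfl⟩
      · simpa using (hne (j - 1)).symm
      · have := h.bounce (j - 1)
        rw [sub_add_cancel] at this
        refine mem_frontier_of_normal (h.q_mem j) this ?_
        rw [neg_ne_zero, sub_ne_zero]
        exact (hdeg j).2.1
      · exact mem_frontier_of_normal (h.p_mem j) (h.edge j) (sub_ne_zero.2 (hne j).symm)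

lemma IsStrongBilliard.exists_weak (hK : IsBody K) (hT : IsBody T) {r : ClosedPolygon E}
    (h : IsStrongBilliard K T r) : ∃ p, IsWeakBilliard K T r.vertex p := by
  obtain ⟨hq, p, hp, hqp⟩ := h
  exact ⟨p, fun j ↦ hK.isCompact.isClosed.frontier_subset (hq j),
    fun j ↦ hT.isCompact.isClosed.frontier_subset (hp j), fun j ↦ (hqp j).1, fun j ↦ (hqp j).2⟩

lemma length_pos (hT : IsBody T) (r : ClosedPolygon E) : 0 < length T r :=
  Finset.sum_pos (fun j _ ↦ hT.gauge_pos (sub_ne_zero.2 (r.ne_next j).symm)) Finset.univ_nonempty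

/-- A closed polygon can be translated into the interior iff its vertices can. -/
lemma mem_F_iff (hK : IsBody K) {N : ℕ} {r : ClosedPolygon E} :
    r ∈ F N K ↔ r.m ≤ N ∧ Untranslatable K r.vertex := by
  refine and_congr_right fun _ ↦ forall_congr' fun v ↦ ?_
  rw [← not_iff_not, not_not]
  push Not
  constructor
  · rintro h j
    exact h ⟨_, mem_iUnion.2 ⟨j, left_mem_segment ℝ _ _⟩, rfl⟩
  · rintro h _ ⟨x, hx, rfl⟩
    obtain ⟨j, a, b, ha, hb, hab, rfl⟩ := mem_iUnion.1 hx
    have := hK.convex.interior (h j) (h (j + 1)) ha hb hab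
    convert this using 1
    calc _ = a • r.vertex j + b • r.vertex (j + 1) + (a + b) • v := by rw [hab, one_smul]
      _ = _ := by module

lemma M_subset_F (hK : IsBody K) (hT : IsBody T) (N : ℕ) : M N K T ⊆ F N K := by
  rintro r ⟨hr, h⟩
  obtain ⟨p, hp⟩ := h.exists_weak hK hT
  exact (mem_F_iff hK).2 ⟨hr, hp.untranslatable_q hK hT (length_pos hT r)⟩

/-- An untranslatable loop can be padded by repeating a vertex. -/
lemma Untranslatable.exists_pad {k N : ℕ} (hkN : k ≤ N) {w : Fin (k + 1) → E}
    (h : Untranslatable K w) (T : Set E) :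
    ∃ w' : Fin (N + 1) → E, Untranslatable K w' ∧ loopLength T w' = loopLength T w := by
  induction N, hkN using Nat.le_induction with
  | base => exact ⟨w, h, rfl⟩
  | succ N _ ih =>
    obtain ⟨w', hw', hlen⟩ := ih
    refine ⟨Fin.snoc w' (w' (Fin.last N)), fun v ↦ ?_, ?_⟩
    · obtain ⟨j, hj⟩ := hw' v
      exact ⟨j.castSucc, by simpa using hj⟩
    · have h1 := loopLength_castSucc T (Fin.snoc w' (w' (Fin.last N)) : Fin (N + 2) → E)
      have h0 : (Fin.snoc w' (w' (Fin.last N)) : Fin (N + 2) → E) 0 = w' 0 := by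
        rw [← Fin.castSucc_zero, Fin.snoc_castSucc]
      simp only [Fin.snoc_castSucc, Fin.snoc_last, h0, sub_self, gauge_zero] at h1
      linarith

lemma exists_pad_of_mem_F (hK : IsBody K) (T : Set E) {N : ℕ} {r : ClosedPolygon E}
    (hr : r ∈ F (N + 1) K) :
    ∃ w : Fin (N + 1) → E, Untranslatable K w ∧ loopLength T w = length T r := by
  obtain ⟨hm, hu⟩ := (mem_F_iff hK).1 hr
  obtain ⟨m, h2, v, h3, h4⟩ := r
  obtain ⟨k, rfl⟩ := Nat.exists_eq_succ_of_ne_zero (NeZero.ne m)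
  exact Untranslatable.exists_pad (Nat.le_of_succ_le_succ hm) hu T

end Reduction

/-! ### Equality of the polygon minima -/

section MinimalValue

variable {E : Type*} [NormedAddCommGroup E] [InnerProductSpace ℝ E] [FiniteDimensional ℝ E]
  [Nontrivial E] {K T : Set E}

/-- The minimal length of an untranslatable loop is attained by a strong billiard trajectory. -/
lemma exists_minimal_billiard (hK : IsBody K) (hT : IsBody T) {N : ℕ} (hN : 1 ≤ N) :
    ∃ L, (∃ r ∈ M (N + 1) K T, length T r = L) ∧
      (∀ w : Fin (N + 1) → E, Untranslatable K w → L ≤ loopLength T w) ∧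
      ∃ w : Fin (N + 1) → E, Untranslatable T w ∧ loopLength K w = L := by
  obtain ⟨w, hw, hmin⟩ := exists_minimal_loop hK hT (m := N + 1) (by omega)
  obtain ⟨q, p, hqp, hlen⟩ := exists_weakBilliard_of_minimal hK hT hw hmin
  have hpos : 0 < loopLength T q := hlen ▸ hw.loopLength_pos hK hT
  obtain ⟨r, hr, hr'⟩ := hqp.exists_strong hT hpos
  obtain ⟨w', hw', hlen'⟩ := hqp.exists_dual_loop hK hT hpos
  exact ⟨loopLength T w, ⟨r, hr, hr'.trans hlen⟩, hmin, w', hw', hlen'.trans hlen⟩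

/-- The three minima over polygons exist and agree. -/
lemma exists_isLeast_length (hK : IsBody K) (hT : IsBody T) {N : ℕ} (hN : 1 ≤ N) :
    ∃ L, IsLeast (length T '' F (N + 1) K) L ∧ IsLeast (length K '' F (N + 1) T) L ∧
      IsLeast (length T '' M (N + 1) K T) L ∧
      ∀ w : Fin (N + 1) → E, Untranslatable K w → L ≤ loopLength T w := by
  obtain ⟨L, ⟨r, hr, hrL⟩, hmin, w, hw, hwL⟩ := exists_minimal_billiard hK hT hN
  obtain ⟨L', ⟨r', hr', hrL'⟩, hmin', w', hw', hwL'⟩ := exists_minimal_billiard hT hK hN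
  -- Each minimizing trajectory supplies, through its momenta, a competitor for the problem with K
  -- and T exchanged.
  obtain rfl : L = L' := le_antisymm (hwL' ▸ hmin w' hw') (hwL ▸ hmin' w hw)
  have hF : ∀ s ∈ F (N + 1) K, L ≤ length T s := fun s hs ↦ by
    obtain ⟨u, hu, hlen⟩ := exists_pad_of_mem_F hK T hs
    exact hlen ▸ hmin u hu
  have hF' : ∀ s ∈ F (N + 1) T, L ≤ length K s := fun s hs ↦ by
    obtain ⟨u, hu, hlen⟩ := exists_pad_of_mem_F hT K hs
    exact hlen ▸ hmin' u hu
  refine ⟨L, ⟨⟨r, M_subset_F hK hT _ hr, hrL⟩, ?_⟩, ⟨⟨r', M_subset_F hT hK _ hr', hrL'⟩, ?_⟩,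
    ⟨⟨r, hr, hrL⟩, ?_⟩, hmin⟩
  · rintro _ ⟨s, hs, rfl⟩
    exact hF s hs
  · rintro _ ⟨s, hs, rfl⟩
    exact hF' s hs
  · rintro _ ⟨s, hs, rfl⟩
    exact hF s (M_subset_F hK hT _ hs)

end MinimalValue

/-! ### Subgradients on the energy surface -/

section Subdifferential

variable {V : Type*} [NormedAddCommGroup V] [InnerProductSpace ℝ V]

/-- Euler's relation and the normality of subgradients on the energy surface. -/
lemma subgradient_of_energy {C : Set V} {x ξ : V} (hx : hamiltonian C x = 1 / 2)
    (hξ : ξ ∈ subdifferential (hamiltonian C) x) :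
    inner ℝ ξ x = 1 ∧ ∀ y ∈ C, inner ℝ ξ y ≤ 1 := by
  have hray : ∀ s : ℝ, 0 ≤ s → 1 / 2 + (s - 1) * inner ℝ ξ x ≤ s ^ 2 / 2 := by
    intro s hs
    have h1 := hξ (s • x)
    have h2 : hamiltonian C (s • x) = s ^ 2 / 2 := by
      rw [hamiltonian, gauge_smul_nonneg _ hs]
      rw [hamiltonian] at hx
      linear_combination s ^ 2 * hx
    rw [hx, h2, inner_sub_right, inner_smul_right] at h1
    linarith
  have hpos : 0 ≤ inner ℝ ξ x := by linarith [hray 0 le_rfl]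
  have h1 : inner ℝ ξ x = 1 := by
    -- Taking s = ⟨ξ, x⟩ gives (⟨ξ, x⟩ - 1)² ≤ 0.
    have := hray _ hpos
    nlinarith [sq_nonneg (inner ℝ ξ x - 1)]
  refine ⟨h1, fun y hy ↦ ?_⟩
  have h2 := hξ y
  have h3 : hamiltonian C y ≤ 1 / 2 := by
    have h4 := gauge_le_one_of_mem hy
    have h5 := gauge_nonneg (s := C) y
    rw [hamiltonian]
    nlinarith
  rw [hx, inner_sub_right, h1] at h2
  linarith

/-- A normalized normal is a subgradient of the Hamiltonian. -/
lemma mem_subdifferential_of_normal {C : Set V} (hC : Absorbent ℝ C) {x ξ : V} (hx : x ∈ C)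
    (hξx : inner ℝ ξ x = 1) (hξ : ∀ y ∈ C, inner ℝ ξ y ≤ 1) :
    hamiltonian C x = 1 / 2 ∧ ξ ∈ subdifferential (hamiltonian C) x := by
  have hg : gauge C x = 1 :=
    le_antisymm (gauge_le_one_of_mem hx) (hξx ▸ inner_le_gauge hC hξ x)
  have hH : hamiltonian C x = 1 / 2 := by rw [hamiltonian, hg]; norm_num
  refine ⟨hH, fun y ↦ ?_⟩
  rw [hH, inner_sub_right, hξx, hamiltonian]
  nlinarith [inner_le_gauge hC hξ y, sq_nonneg (gauge C y - 1)]

lemma mem_of_energy {C : Set V} (hC : IsBody C) {x : V} (hx : hamiltonian C x = 1 / 2) :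
    x ∈ C := by
  have h : gauge C x ≤ 1 := by
    rw [hamiltonian] at hx
    nlinarith [gauge_nonneg (s := C) x]
  have := (gauge_le_one_iff_mem_closure hC.convex hC.mem_nhds).1 h
  rwa [hC.isCompact.isClosed.closure_eq] at this

end Subdifferential

/-! ### Phase space and the action -/

section Phase

variable {E : Type*} [NormedAddCommGroup E] [InnerProductSpace ℝ E] {K T : Set E}

lemma IsBody.lagrangianProduct (hK : IsBody K) (hT : IsBody T) :
    IsBody (lagrangianProduct K T) := by
  have hpre : MinkowskiBilliards.lagrangianProduct K T =
      WithLp.prodContinuousLinearEquiv 2 ℝ E E ⁻¹' (K ×ˢ T) := rfl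
  refine ⟨?_, ?_, ?_⟩
  · rw [hpre]
    exact (hK.convex.prod hT.convex).linear_preimage
      (WithLp.prodContinuousLinearEquiv 2 ℝ E E).toLinearEquiv.toLinearMap
  · rw [hpre]
    exact (WithLp.prodContinuousLinearEquiv 2 ℝ E E).toHomeomorph.isCompact_preimage.2
      (hK.isCompact.prod hT.isCompact)
  · rw [mem_interior_iff_mem_nhds, hpre]
    refine (WithLp.prodContinuousLinearEquiv 2 ℝ E E).continuous.continuousAt.preimage_mem_nhds ?_
    rw [map_zero]
    exact prod_mem_nhds hK.mem_nhds hT.mem_nhds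

lemma inner_J (ξ x : PhaseSpace E) :
    inner ℝ (J ξ) x = inner ℝ ξ.snd x.fst - inner ℝ ξ.fst x.snd := by
  simp [J, WithLp.prod_inner_apply, sub_eq_add_neg]

lemma J_J {E : Type*} [NormedAddCommGroup E] (x : PhaseSpace E) : J (J x) = -x := by
  apply (WithLp.equiv 2 (E × E)).injective
  ext <;> simp [J]

/-- On the energy surface the action is half the period. -/
lemma IsClosedCharacteristic.action_eq {C : Set (PhaseSpace E)} {τ : ℝ} {x : ℝ → PhaseSpace E}
    (h : IsClosedCharacteristic C τ x) : action τ x = τ / 2 := by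
  have : ∫ t in (0 : ℝ)..τ, inner ℝ (J (deriv x t)) (x t) = ∫ _ in (0 : ℝ)..τ, (-1 : ℝ) := by
    refine intervalIntegral.integral_congr_ae ?_
    filter_upwards [h.inclusion] with t ht _
    obtain ⟨ξ, hξ, hd⟩ := ht
    rw [hd.deriv, J_J, inner_neg_left, (subgradient_of_energy (h.energy t) hξ).1]
  rw [action, this, intervalIntegral.integral_const]
  simp
  ring

end Phase

/-! ### Calculus of absolutely continuous curves -/

section AbsolutelyContinuous

variable {E : Type*} [NormedAddCommGroup E] [InnerProductSpace ℝ E]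

lemma absolutelyContinuous_lipschitz_comp {X Y : Type*} [PseudoMetricSpace X]
    [PseudoMetricSpace Y] {f : ℝ → X} {g : X → Y} {a b : ℝ} {M : NNReal} (hg : LipschitzWith M g)
    (hf : AbsolutelyContinuousOnInterval f a b) :
    AbsolutelyContinuousOnInterval (fun t ↦ g (f t)) a b := by
  refine squeeze_zero (fun t ↦ Finset.sum_nonneg fun i _ ↦ dist_nonneg) (fun t ↦ ?_)
    (by simpa using Tendsto.const_mul (M : ℝ) hf)
  rw [Finset.mul_sum]
  exact Finset.sum_le_sum fun i _ ↦ hg.dist_le_mul _ _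

/-- Polarization reduces this to products of real-valued norms. -/
lemma absolutelyContinuous_inner {f g : ℝ → E} {a b : ℝ}
    (hf : AbsolutelyContinuousOnInterval f a b) (hg : AbsolutelyContinuousOnInterval g a b) :
    AbsolutelyContinuousOnInterval (fun t ↦ inner ℝ (f t) (g t)) a b := by
  have hnorm : ∀ {h : ℝ → E}, AbsolutelyContinuousOnInterval h a b →
      AbsolutelyContinuousOnInterval (fun t ↦ ‖h t‖ * ‖h t‖) a b := fun hh ↦
    (absolutelyContinuous_lipschitz_comp lipschitzWith_one_norm hh).fun_mul
      (absolutelyContinuous_lipschitz_comp lipschitzWith_one_norm hh)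
  have := (((hnorm (hf.fun_add hg)).fun_sub (hnorm hf)).fun_sub (hnorm hg)).const_mul (1 / 2)
  convert this using 2 with t
  rw [real_inner_eq_norm_add_mul_self_sub_norm_mul_self_sub_norm_mul_self_div_two]
  ring

lemma absolutelyContinuous_id (a b : ℝ) : AbsolutelyContinuousOnInterval (fun t : ℝ ↦ t) a b :=
  (LipschitzWith.id.lipschitzOnWith).absolutelyContinuousOnInterval

lemma le_of_ae_hasDerivAt_nonneg {f : ℝ → ℝ} {a b : ℝ} (hab : a ≤ b)
    (hf : AbsolutelyContinuousOnInterval f a b)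
    (h : ∀ᵐ t, t ∈ Icc a b → ∃ d, HasDerivAt f d t ∧ 0 ≤ d) : f a ≤ f b := by
  rw [← sub_nonneg, ← hf.integral_deriv_eq_sub]
  refine intervalIntegral.integral_nonneg_of_ae_restrict hab ?_
  refine (ae_restrict_iff' measurableSet_Icc).2 ?_
  filter_upwards [h] with t ht hmem
  obtain ⟨d, hd, hd0⟩ := ht hmem
  rwa [Pi.zero_apply, hd.deriv]

end AbsolutelyContinuous

/-! ### Lower bound for the action -/

section LowerBound

variable {E : Type*} [NormedAddCommGroup E] [InnerProductSpace ℝ E] {K T : Set E} {τ : ℝ}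
  {x : ℝ → PhaseSpace E}

namespace IsClosedCharacteristic

/-- Varying one factor of the product at a time splits the subgradient into a normal to K and a
normal to T, and Euler's relation normalizes them jointly. -/
lemma ae_derivatives (hK : IsBody K) (hT : IsBody T)
    (h : IsClosedCharacteristic (lagrangianProduct K T) τ x) :
    ∀ᵐ t, ∃ ξ η : E, HasDerivAt (fun t ↦ (x t).fst) η t ∧ HasDerivAt (fun t ↦ (x t).snd) (-ξ) t ∧
      ξ ∈ normalCone K (x t).fst ∧ η ∈ normalCone T (x t).snd ∧
      inner ℝ ξ (x t).fst + inner ℝ η (x t).snd = 1 := by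
  filter_upwards [h.inclusion] with t ht
  obtain ⟨ξ, hξ, hd⟩ := ht
  obtain ⟨h1, h2⟩ := subgradient_of_energy (h.energy t) hξ
  have hmem := mem_of_energy (hK.lagrangianProduct hT) (h.energy t)
  rw [WithLp.prod_inner_apply] at h1
  refine ⟨ξ.fst, ξ.snd, ?_, ?_, fun y hy ↦ ?_, fun y hy ↦ ?_, h1⟩
  · exact (WithLp.fstL 2 ℝ E E).hasFDerivAt.comp_hasDerivAt t hd
  · exact (WithLp.sndL 2 ℝ E E).hasFDerivAt.comp_hasDerivAt t hd
  · have := h2 (WithLp.toLp 2 (y, (x t).snd)) ⟨hy, hmem.2⟩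
    rw [WithLp.prod_inner_apply] at this
    rw [inner_sub_right]
    simp only [WithLp.ofLp_fst, WithLp.ofLp_snd] at this h1
    linarith
  · have := h2 (WithLp.toLp 2 ((x t).fst, y)) ⟨hmem.1, hy⟩
    rw [WithLp.prod_inner_apply] at this
    rw [inner_sub_right]
    simp only [WithLp.ofLp_fst, WithLp.ofLp_snd] at this h1
    linarith

lemma absolutelyContinuous_fst {C : Set (PhaseSpace E)} (h : IsClosedCharacteristic C τ x) :
    AbsolutelyContinuousOnInterval (fun t ↦ (x t).fst) 0 τ :=
  absolutelyContinuous_lipschitz_comp (WithLp.fstL 2 ℝ E E).lipschitz h.absolutelyContinuous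

lemma absolutelyContinuous_snd {C : Set (PhaseSpace E)} (h : IsClosedCharacteristic C τ x) :
    AbsolutelyContinuousOnInterval (fun t ↦ (x t).snd) 0 τ :=
  absolutelyContinuous_lipschitz_comp (WithLp.sndL 2 ℝ E E).lipschitz h.absolutelyContinuous

/-- The `q`-length of a characteristic is controlled by the increments of
`(t + ⟨q, p⟩) / 2`. -/
lemma gauge_sub_le (hK : IsBody K) (hT : IsBody T)
    (h : IsClosedCharacteristic (lagrangianProduct K T) τ x) {s t : ℝ} (hs : 0 ≤ s) (hst : s ≤ t)
    (ht : t ≤ τ) : gauge (polarBody T) ((x t).fst - (x s).fst) ≤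
      (t + inner ℝ (x t).fst (x t).snd) / 2 - (s + inner ℝ (x s).fst (x s).snd) / 2 := by
  obtain ⟨y, hy, hgy⟩ := hT.exists_gauge_eq ((x t).fst - (x s).fst)
  have hsub : uIcc s t ⊆ uIcc 0 τ := by
    rw [uIcc_of_le hst, uIcc_of_le (hs.trans (hst.trans ht))]
    exact Icc_subset_Icc hs ht
  have hq := h.absolutelyContinuous_fst.mono hsub
  have hp := h.absolutelyContinuous_snd.mono hsub
  -- The derivative of (t + ⟨q, p⟩)/2 is ⟨η, p⟩ by Euler's relation, and normality of η gives ⟨η, p⟩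
  -- ≥ ⟨η, y⟩.
  have hac := ((((absolutelyContinuous_id s t).fun_add (absolutelyContinuous_inner hq hp)).const_mul
    (1 / 2)).fun_sub (absolutelyContinuous_lipschitz_comp (innerSL ℝ y).lipschitz hq))
  have := le_of_ae_hasDerivAt_nonneg hst hac (by
    filter_upwards [h.ae_derivatives hK hT] with u hu _
    obtain ⟨ξ, η, h1, h2, h3, h4, h5⟩ := hu
    refine ⟨_, (((hasDerivAt_id u).add (h1.inner ℝ h2)).const_mul (1 / 2)).sub
      ((innerSL ℝ y).hasFDerivAt.comp_hasDerivAt u h1), ?_⟩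
    have h6 := h4 y hy
    rw [inner_sub_right] at h6
    simp only [innerSL_apply_apply, inner_neg_right]
    rw [real_inner_comm ξ, real_inner_comm η y]
    linarith)
  simp only [innerSL_apply_apply] at this
  rw [hgy, inner_sub_left, real_inner_comm y, real_inner_comm y]
  linarith

/-- The `q`-curve of a characteristic cannot be translated into a shrunken copy of `K`. -/
lemma exists_forall_ne_smul (hK : IsBody K) (hT : IsBody T)
    (h : IsClosedCharacteristic (lagrangianProduct K T) τ x) {r : ℝ} (hr0 : 0 ≤ r) (hr : r < 1)
    (v : E) : ∃ t ∈ Icc 0 τ, ∀ k ∈ K, (x t).fst + v ≠ r • k := by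
  by_contra! hcon
  have hq := h.absolutelyContinuous_fst
  have hp := h.absolutelyContinuous_snd
  -- The derivative of (t - ⟨q, p⟩)/2 is ⟨ξ, q⟩. If q + v always lay in rK, normality would make ⟨v,
  -- p⟩ - (1 - r)(t - ⟨q, p⟩)/2 nondecreasing, yet over a period it drops by (1 - r)τ/2.
  have hac := (absolutelyContinuous_lipschitz_comp (innerSL ℝ v).lipschitz hp).fun_sub
    (((absolutelyContinuous_id 0 τ).fun_sub (absolutelyContinuous_inner hq hp)).const_mul
    ((1 - r) / 2))
  have hle := le_of_ae_hasDerivAt_nonneg h.period_pos.le hac (by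
    filter_upwards [h.ae_derivatives hK hT] with u hu hmem
    obtain ⟨ξ, η, h1, h2, h3, h4, h5⟩ := hu
    refine ⟨_, ((innerSL ℝ v).hasFDerivAt.comp_hasDerivAt u h2).sub
      (((hasDerivAt_id u).sub (h1.inner ℝ h2)).const_mul ((1 - r) / 2)), ?_⟩
    obtain ⟨k, hk, hk'⟩ := hcon u hmem
    have h6 := h3 k hk
    have h7 : inner ℝ ξ ((x u).fst + v) = inner ℝ ξ (r • k) := congrArg _ hk'
    rw [inner_sub_right] at h6
    rw [inner_add_right, inner_smul_right] at h7
    simp only [innerSL_apply_apply, inner_neg_right]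
    rw [real_inner_comm ξ, real_inner_comm ξ (x u).fst]
    nlinarith)
  have hper : x τ = x 0 := by simpa using h.periodic 0
  simp only [hper] at hle
  nlinarith [h.period_pos]

end IsClosedCharacteristic

lemma sum_fin_succ_sub (k : ℕ) (f : Fin (k + 1) → ℝ) :
    ∑ i : Fin k, (f i.succ - f i.castSucc) = f (Fin.last k) - f 0 := by
  have h1 := Fin.sum_univ_succ f
  have h2 := Fin.sum_univ_castSucc f
  rw [Finset.sum_sub_distrib]
  linarith

/-- The bounds telescope along increasing times; the closing edge is split at time τ, identified
with 0, by the triangle inequality. -/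
lemma IsClosedCharacteristic.loopLength_le (hK : IsBody K) (hT : IsBody T)
    (h : IsClosedCharacteristic (lagrangianProduct K T) τ x) {N : ℕ}
    {t : Fin (N + 1) → Icc 0 τ} (ht : Monotone t) :
    loopLength T (fun j ↦ (x (t j)).fst) ≤ τ / 2 := by
  set Φ : ℝ → ℝ := fun t ↦ (t + inner ℝ (x t).fst (x t).snd) / 2 with hΦ
  have hper : x τ = x 0 := by simpa using h.periodic 0
  have hsum : ∑ i : Fin N, gauge (polarBody T) ((x (t i.succ)).fst - (x (t i.castSucc)).fst) ≤
      Φ (t (Fin.last N)) - Φ (t 0) := by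
    rw [← sum_fin_succ_sub N fun j ↦ Φ (t j)]
    exact Finset.sum_le_sum fun i _ ↦ h.gauge_sub_le hK hT (t _).2.1
      (ht (Fin.castSucc_lt_succ).le) (t _).2.2
  have h1 := h.gauge_sub_le hK hT le_rfl (t 0).2.1 (t 0).2.2
  have h2 := h.gauge_sub_le hK hT (t (Fin.last N)).2.1 (t (Fin.last N)).2.2 le_rfl
  have h3 := hT.gauge_add_le ((x (t 0)).fst - (x 0).fst) ((x τ).fst - (x (t (Fin.last N))).fst)
  rw [hper, sub_add_sub_cancel] at h3
  rw [loopLength_succ]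
  simp only [hΦ] at hsum
  rw [hper] at h2
  linarith

/-- A finset of size at most `N + 1` is contained in the range of a monotone map. -/
lemma exists_monotone_cover {α : Type*} [LinearOrder α] {I : Finset α} (hI : I.Nonempty) {N : ℕ}
    (hN : I.card ≤ N + 1) : ∃ t : Fin (N + 1) → α, Monotone t ∧ ∀ i ∈ I, ∃ j, t j = i := by
  obtain ⟨i₀, hi₀⟩ := hI
  set f : Fin (N + 1) → α := fun j ↦
    if h : j.val < I.card then (I.equivFin.symm ⟨j.val, h⟩ : α) else i₀ with hf
  refine ⟨f ∘ Tuple.sort f, Tuple.monotone_sort f, fun i hi ↦ ?_⟩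
  refine ⟨(Tuple.sort f).symm ⟨I.equivFin ⟨i, hi⟩, (I.equivFin ⟨i, hi⟩).isLt.trans_le hN⟩, ?_⟩
  simp [hf]

/-- The action of a closed characteristic is bounded below by the minimal length of an
untranslatable loop. -/
lemma IsClosedCharacteristic.le_action [FiniteDimensional ℝ E] (hK : IsBody K) (hT : IsBody T)
    (h : IsClosedCharacteristic (lagrangianProduct K T) τ x) {N : ℕ}
    (hN : Module.finrank ℝ E ≤ N) {L : ℝ}
    (hL : ∀ w : Fin (N + 1) → E, Untranslatable K w → L ≤ loopLength T w) :
    L ≤ action τ x := by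
  rw [h.action_eq]
  have key : ∀ r : ℝ, 0 < r → r < 1 → r * L ≤ τ / 2 := by
    intro r hr0 hr1
    -- G t consists of the v with q(t) + v in rK. Shrinking by r < 1 allows closed bodies, so that
    -- Helly's theorem for infinitely many compact convex sets applies.
    set G : Icc 0 τ → Set E := fun t ↦ (fun v ↦ (x t).fst + v) ⁻¹' ((fun k ↦ r • k) '' K) with hG
    have hempty : ¬ (⋂ t, G t).Nonempty := by
      rintro ⟨v, hv⟩
      obtain ⟨t, ht, hne⟩ := h.exists_forall_ne_smul hK hT hr0.le hr1 v
      obtain ⟨k, hk, hk'⟩ := mem_iInter.1 hv ⟨t, ht⟩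
      exact hne k hk hk'.symm
    have hhelly : ∃ I : Finset (Icc 0 τ), I.card ≤ Module.finrank ℝ E + 1 ∧
        ¬ (⋂ t ∈ I, G t).Nonempty := by
      by_contra! hcon
      refine hempty (Convex.helly_theorem_compact' (𝕜 := ℝ) (fun t ↦ ?_) (fun t ↦ ?_) hcon)
      · exact (hK.convex.smul r).translate_preimage_right _
      · exact (Homeomorph.addLeft (x t).fst).isCompact_preimage.2
          (hK.isCompact.image (continuous_const_smul r))
    obtain ⟨I, hI, hIe⟩ := hhelly
    have hIne : I.Nonempty := by
      rw [Finset.nonempty_iff_ne_empty]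
      rintro rfl
      exact hIe (by simp)
    obtain ⟨t, ht, hcov⟩ := exists_monotone_cover hIne (hI.trans (Nat.succ_le_succ hN))
    have hunt : Untranslatable K (r⁻¹ • fun j ↦ (x (t j)).fst) := by
      intro v
      by_contra! hcon
      refine hIe ⟨r • v, mem_iInter₂.2 fun i hi ↦ ?_⟩
      obtain ⟨j, rfl⟩ := hcov i hi
      refine ⟨_, interior_subset (hcon j), ?_⟩
      simp [smul_inv_smul₀ hr0.ne']
    have h1 := hL _ hunt
    rw [loopLength_smul _ (by positivity), le_inv_mul_iff₀ hr0] at h1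
    exact h1.trans (h.loopLength_le hK hT ht)
  by_contra! hcon
  have hτ : 0 < τ / 2 := half_pos h.period_pos
  have hLpos : 0 < L := hτ.trans hcon
  obtain ⟨r, hr1, hr2⟩ := exists_between ((div_lt_one hLpos).2 hcon)
  have := key r ((div_pos hτ hLpos).trans hr1) hr2
  rw [div_lt_iff₀ hLpos] at hr1
  linarith

end LowerBound

/-! ### Lifting a billiard trajectory to a closed characteristic -/

section Construction

variable {E : Type*} [NormedAddCommGroup E] [InnerProductSpace ℝ E]
  {C : Set (PhaseSpace E)}

/-- The curve `x` satisfies Hamilton's inclusion at time `t`. -/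
def SolvesAt (C : Set (PhaseSpace E)) (x : ℝ → PhaseSpace E) (t : ℝ) : Prop :=
  ∃ ξ ∈ subdifferential (hamiltonian C) (x t), HasDerivAt x (J ξ) t

lemma SolvesAt.congr {x y : ℝ → PhaseSpace E} {t : ℝ} (h : SolvesAt C x t) (hxy : y =ᶠ[𝓝 t] x) :
    SolvesAt C y t := by
  obtain ⟨ξ, hξ, hd⟩ := h
  exact ⟨ξ, hxy.eq_of_nhds ▸ hξ, hd.congr_of_eventuallyEq hxy⟩

lemma SolvesAt.comp_sub {x : ℝ → PhaseSpace E} {t s : ℝ} (h : SolvesAt C x (t - s)) :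
    SolvesAt C (fun u ↦ x (u - s)) t := by
  obtain ⟨ξ, hξ, hd⟩ := h
  exact ⟨ξ, hξ, hd.comp_sub_const t s⟩

/-- A Lipschitz arc on the energy surface that solves Hamilton's inclusion and runs from `a` to
`b` in time `τ`. -/
structure IsArc (C : Set (PhaseSpace E)) (τ : ℝ) (a b : PhaseSpace E) (x : ℝ → PhaseSpace E) :
    Prop where
  nonneg : 0 ≤ τ
  start : x 0 = a
  finish : x τ = b
  lipschitz : ∃ M, LipschitzOnWith M x (Icc 0 τ)
  energy : ∀ t ∈ Icc 0 τ, hamiltonian C (x t) = 1 / 2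
  inclusion : ∀ᵐ t : ℝ, t ∈ Ioo 0 τ → SolvesAt C x t

/-- The point `b` can be reached from `a` in time `τ`. -/
def Reaches (C : Set (PhaseSpace E)) (τ : ℝ) (a b : PhaseSpace E) : Prop := ∃ x, IsArc C τ a b x

lemma ae_comp_sub {P : ℝ → Prop} (h : ∀ᵐ t, P t) (s : ℝ) : ∀ᵐ t, P (t - s) :=
  (measurePreserving_sub_right volume s).quasiMeasurePreserving.ae h

lemma ae_ne (s : ℝ) : ∀ᵐ t : ℝ, t ≠ s := by
  simp [ae_iff]

lemma lipschitzOnWith_Icc_append {X : Type*} [PseudoMetricSpace X] {f : ℝ → X} {a b c : ℝ}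
    {M : NNReal} (hab : a ≤ b) (hbc : b ≤ c) (h1 : LipschitzOnWith M f (Icc a b))
    (h2 : LipschitzOnWith M f (Icc b c)) : LipschitzOnWith M f (Icc a c) := by
  have key : ∀ s t, s ∈ Icc a c → t ∈ Icc a c → s ≤ t → dist (f s) (f t) ≤ M * dist s t := by
    intro s t hs ht hst
    rcases le_total t b with htb | htb
    · exact h1.dist_le_mul s ⟨hs.1, hst.trans htb⟩ t ⟨ht.1, htb⟩
    rcases le_total b s with hbs | hbs
    · exact h2.dist_le_mul s ⟨hbs, hs.2⟩ t ⟨htb, ht.2⟩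
    · have e1 := h1.dist_le_mul s ⟨hs.1, hbs⟩ b ⟨hab, le_rfl⟩
      have e2 := h2.dist_le_mul b ⟨le_rfl, hbc⟩ t ⟨htb, ht.2⟩
      have e3 := dist_triangle (f s) (f b) (f t)
      rw [Real.dist_eq, abs_of_nonpos (by linarith)] at e1 e2 ⊢
      linarith
  refine LipschitzOnWith.of_dist_le_mul fun s hs t ht ↦ ?_
  rcases le_total s t with hst | hst
  · exact key s t hs ht hst
  · rw [dist_comm, dist_comm s]
    exact key t s ht hs hst

lemma Reaches.trans {σ τ : ℝ} {a b c : PhaseSpace E} (h₁ : Reaches C σ a b)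
    (h₂ : Reaches C τ b c) : Reaches C (σ + τ) a c := by
  obtain ⟨x, hx⟩ := h₁
  obtain ⟨y, hy⟩ := h₂
  have hσ := hx.nonneg
  have hτ := hy.nonneg
  set z : ℝ → PhaseSpace E := fun t ↦ if t ≤ σ then x t else y (t - σ) with hz
  have hz1 : ∀ t, t ≤ σ → z t = x t := fun t ht ↦ if_pos ht
  have hz2 : ∀ t, σ ≤ t → z t = y (t - σ) := fun t ht ↦ by
    rcases ht.eq_or_lt with rfl | ht
    · rw [hz1 _ le_rfl, sub_self, hx.finish, hy.start]
    · exact if_neg ht.not_ge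
  have hshift : ∀ t, t ∈ Icc σ (σ + τ) → t - σ ∈ Icc 0 τ := fun t ht ↦
    ⟨by linarith [ht.1], by linarith [ht.2]⟩
  refine ⟨z, add_nonneg hσ hτ, (hz1 0 hσ).trans hx.start, ?_, ?_, ?_, ?_⟩
  · rw [hz2 _ (by linarith), add_sub_cancel_left, hy.finish]
  · obtain ⟨M₁, hM₁⟩ := hx.lipschitz
    obtain ⟨M₂, hM₂⟩ := hy.lipschitz
    refine ⟨max M₁ M₂, lipschitzOnWith_Icc_append hσ (by linarith) ?_ ?_⟩
    · intro s hs t ht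
      rw [hz1 s hs.2, hz1 t ht.2]
      exact hM₁.weaken (le_max_left _ _) hs ht
    · intro s hs t ht
      rw [hz2 s hs.1, hz2 t ht.1]
      refine (hM₂.weaken (le_max_right M₁ M₂) (hshift s hs) (hshift t ht)).trans_eq ?_
      rw [edist_dist, edist_dist, dist_sub_right]
  · intro t ht
    rcases le_total t σ with h | h
    · rw [hz1 t h]
      exact hx.energy t ⟨ht.1, h⟩
    · rw [hz2 t h]
      exact hy.energy _ (hshift t ⟨h, ht.2⟩)
  · filter_upwards [hx.inclusion, ae_comp_sub hy.inclusion σ, ae_ne σ] with t h1 h2 h3 ht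
    rcases h3.lt_or_gt with h | h
    · exact (h1 ⟨ht.1, h⟩).congr (by filter_upwards [Iio_mem_nhds h] with u hu using hz1 u hu.le)
    · exact (h2 ⟨by linarith, by linarith [ht.2]⟩).comp_sub.congr
        (by filter_upwards [Ioi_mem_nhds h] with u hu using hz2 u hu.le)

lemma J_smul (s : ℝ) (ξ : PhaseSpace E) : J (s • ξ) = s • J ξ := by
  simp [J, ← WithLp.toLp_smul]

/-- A straight segment in a fixed normal direction is an arc. -/
lemma reaches_segment (hCa : Absorbent ℝ C) (hCc : Convex ℝ C) {a b ξ : PhaseSpace E} {τ : ℝ}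
    (hτ : 0 ≤ τ) (hb : b = a + τ • J ξ) (haC : a ∈ C) (hbC : b ∈ C) (hξa : inner ℝ ξ a = 1)
    (hξ : ∀ y ∈ C, inner ℝ ξ y ≤ 1) : Reaches C τ a b := by
  have hmem : ∀ t ∈ Icc 0 τ, a + t • J ξ ∈ C := by
    intro t ht
    rcases hτ.eq_or_lt with rfl | hpos
    · obtain rfl : t = 0 := le_antisymm ht.2 ht.1
      simpa using haC
    · have := hCc.add_smul_sub_mem haC hbC (t := t / τ)
        ⟨div_nonneg ht.1 hτ, (div_le_one hpos).2 ht.2⟩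
      rwa [hb, add_sub_cancel_left, smul_smul, div_mul_cancel₀ _ hpos.ne'] at this
  -- Skewness of J keeps ⟨ξ, ·⟩ equal to 1 along the segment, so ξ remains a subgradient there.
  have hJ : inner ℝ ξ (J ξ) = 0 := by
    rw [real_inner_comm, inner_J, real_inner_comm, sub_self]
  have hsub : ∀ t ∈ Icc 0 τ, hamiltonian C (a + t • J ξ) = 1 / 2 ∧
      ξ ∈ subdifferential (hamiltonian C) (a + t • J ξ) := fun t ht ↦
    mem_subdifferential_of_normal hCa (hmem t ht)
      (by rw [inner_add_right, inner_smul_right, hJ, hξa]; ring) hξ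
  refine ⟨fun t ↦ a + t • J ξ, hτ, by simp, hb.symm, ⟨‖J ξ‖₊, ?_⟩, fun t ht ↦ (hsub t ht).1, ?_⟩
  · refine LipschitzOnWith.of_dist_le_mul fun s _ t _ ↦ ?_
    rw [dist_add_left, dist_eq_norm, ← sub_smul, norm_smul, mul_comm]
    rfl
  · refine Eventually.of_forall fun t ht ↦ ⟨ξ, (hsub t (Ioo_subset_Icc_self ht)).2, ?_⟩
    simpa using ((hasDerivAt_id t).smul_const (J ξ)).const_add a

/-- A closed arc extends periodically to a closed characteristic. -/
lemma Reaches.exists_isClosedCharacteristic {τ : ℝ} (hτ : 0 < τ) {a : PhaseSpace E}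
    (h : Reaches C τ a a) : ∃ x, IsClosedCharacteristic C τ x := by
  obtain ⟨x, hx⟩ := h
  set z : ℝ → PhaseSpace E := fun t ↦ x (toIcoMod hτ 0 t) with hz
  have hper : Function.Periodic z τ := fun t ↦ by simp only [hz, toIcoMod_add_right]
  have hmod : ∀ t, toIcoMod hτ 0 t ∈ Ico 0 τ := fun t ↦ by simpa using toIcoMod_mem_Ico hτ 0 t
  have hIco : ∀ t ∈ Ico 0 τ, z t = x t := fun t ht ↦ by
    simp only [hz]
    rw [(toIcoMod_eq_self hτ).2 (by simpa using ht)]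
  have hIcc : ∀ t ∈ Icc 0 τ, z t = x t := fun t ht ↦ by
    rcases ht.2.eq_or_lt with rfl | hlt
    · have h0 : z t = z 0 := by simpa using hper 0
      rw [h0, hIco 0 ⟨le_rfl, hτ⟩, hx.start, hx.finish]
    · exact hIco t ⟨ht.1, hlt⟩
  refine ⟨z, hτ, hper, ?_, ?_, fun t ↦ hx.energy _ (Ico_subset_Icc_self (hmod t))⟩
  · obtain ⟨M, hM⟩ := hx.lipschitz
    refine LipschitzOnWith.absolutelyContinuousOnInterval (K := M) ?_
    rw [uIcc_of_le hτ.le]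
    intro s hs t ht
    rw [hIcc s hs, hIcc t ht]
    exact hM hs ht
  · have h1 : ∀ᵐ t : ℝ, ∀ k : ℤ, t - k • τ ∈ Ioo 0 τ → SolvesAt C x (t - k • τ) :=
      ae_all_iff.2 fun k ↦ ae_comp_sub hx.inclusion _
    have h2 : ∀ᵐ t : ℝ, ∀ k : ℤ, t ≠ k • τ := ae_all_iff.2 fun k ↦ ae_ne _
    filter_upwards [h1, h2] with t h1 h2
    have h3 := hmod t
    rw [toIcoMod] at h3
    have h4 : t - toIcoDiv hτ 0 t • τ ∈ Ioo 0 τ :=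
      ⟨h3.1.lt_of_ne' (sub_ne_zero.2 (h2 _)), h3.2⟩
    refine (h1 _ h4).comp_sub.congr ?_
    have h5 : ∀ᶠ u in 𝓝 t, u - toIcoDiv hτ 0 t • τ ∈ Ioo 0 τ :=
      (continuous_id.sub continuous_const).continuousAt.eventually_mem (isOpen_Ioo.mem_nhds h4)
    filter_upwards [h5] with u hu
    rw [← hIco _ (Ioo_subset_Ico_self hu)]
    exact ((hper.zsmul _).sub_eq u).symm

variable {K T : Set E}

/-- The covector (0, q₁ - q₀), divided by its support value, is a normalized normal; J turns it into
pure q-motion. -/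
lemma reaches_q (hK : IsBody K) (hT : IsBody T) {q₀ q₁ p : E} (hq₀ : q₀ ∈ K) (hq₁ : q₁ ∈ K)
    (hp : p ∈ T) (hne : q₁ ≠ q₀) (h : q₁ - q₀ ∈ normalCone T p) :
    Reaches (lagrangianProduct K T) (gauge (polarBody T) (q₁ - q₀))
      (WithLp.toLp 2 (q₀, p)) (WithLp.toLp 2 (q₁, p)) := by
  have hg := hT.gauge_pos (sub_ne_zero.2 hne)
  have hgp := (hT.mem_normalCone_iff hp).1 h
  have hC := hK.lagrangianProduct hT
  refine reaches_segment hC.absorbent hC.convex (ξ := (gauge (polarBody T) (q₁ - q₀))⁻¹ •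
    WithLp.toLp 2 (0, q₁ - q₀)) hg.le ?_ ⟨hq₀, hp⟩ ⟨hq₁, hp⟩ ?_ fun y hy ↦ ?_
  · rw [J_smul, smul_inv_smul₀ hg.ne']
    simp [J, ← WithLp.toLp_add]
  · rw [inner_smul_left, WithLp.prod_inner_apply]
    simp [← hgp, hg.ne']
  · rw [inner_smul_left, WithLp.prod_inner_apply]
    simp only [conj_trivial, inner_zero_left, zero_add]
    rw [inv_mul_le_iff₀ hg, mul_one]
    exact hT.inner_le _ hy.2

lemma reaches_p (hK : IsBody K) (hT : IsBody T) {q p₀ p₁ : E} (hq : q ∈ K) (hp₀ : p₀ ∈ T)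
    (hp₁ : p₁ ∈ T) (hne : p₁ ≠ p₀) (h : -(p₁ - p₀) ∈ normalCone K q) :
    Reaches (lagrangianProduct K T) (gauge (polarBody K) (-(p₁ - p₀)))
      (WithLp.toLp 2 (q, p₀)) (WithLp.toLp 2 (q, p₁)) := by
  have hg := hK.gauge_pos (neg_ne_zero.2 (sub_ne_zero.2 hne))
  have hgp := (hK.mem_normalCone_iff hq).1 h
  have hC := hK.lagrangianProduct hT
  refine reaches_segment hC.absorbent hC.convex (ξ := (gauge (polarBody K) (-(p₁ - p₀)))⁻¹ •
    WithLp.toLp 2 (-(p₁ - p₀), 0)) hg.le ?_ ⟨hq, hp₀⟩ ⟨hq, hp₁⟩ ?_ fun y hy ↦ ?_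
  · rw [J_smul, smul_inv_smul₀ hg.ne']
    simp [J, ← WithLp.toLp_add]
  · rw [inner_smul_left, WithLp.prod_inner_apply]
    simp only [conj_trivial, inner_zero_left, add_zero]
    rw [← hgp, inv_mul_cancel₀ hg.ne']
  · rw [inner_smul_left, WithLp.prod_inner_apply]
    simp only [conj_trivial, inner_zero_left, add_zero]
    rw [inv_mul_le_iff₀ hg, mul_one]
    exact hK.inner_le _ hy.1

lemma reaches_sum {z : ℕ → PhaseSpace E} {σ : ℕ → ℝ}
    (h : ∀ i, Reaches C (σ i) (z i) (z (i + 1))) (s : ℕ) :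
    Reaches C (∑ i ∈ Finset.range (s + 1), σ i) (z 0) (z (s + 1)) := by
  induction s with
  | zero => simpa using h 0
  | succ s ih =>
    rw [Finset.sum_range_succ]
    exact ih.trans (h (s + 1))

/-- A strong billiard trajectory lifts to a closed characteristic whose action is its length. -/
lemma IsStrongBilliard.exists_isClosedCharacteristic (hK : IsBody K) (hT : IsBody T)
    {r : ClosedPolygon E} (h : IsStrongBilliard K T r) :
    ∃ τ x, IsClosedCharacteristic (lagrangianProduct K T) τ x ∧ action τ x = length T r := by
  obtain ⟨p, hp⟩ := h.exists_weak hK hT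
  have hpos := length_pos hT r
  have hsum := hp.sum_bounce_eq hK hT
  obtain ⟨m, _, q, hne, _⟩ := r
  obtain ⟨k, rfl⟩ := Nat.exists_eq_succ_of_ne_zero (NeZero.ne m)
  set σ : Fin (k + 1) → ℝ := fun j ↦
    gauge (polarBody T) (q (j + 1) - q j) + gauge (polarBody K) (-(p (j + 1) - p j)) with hσ
  have hstep : ∀ j, Reaches (lagrangianProduct K T) (σ j) (WithLp.toLp 2 (q j, p j))
      (WithLp.toLp 2 (q (j + 1), p (j + 1))) := by
    intro j
    have h1 := reaches_q hK hT (hp.q_mem j) (hp.q_mem (j + 1)) (hp.p_mem j) (hne j).symm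
      (hp.edge j)
    -- If the momentum does not jump, the p-segment is omitted.
    by_cases hpj : p (j + 1) = p j
    · simpa [hσ, hpj] using h1
    · exact h1.trans (reaches_p hK hT (hp.q_mem _) (hp.p_mem _) (hp.p_mem _) hpj (hp.bounce j))
  have hnat : ∀ i : ℕ, Fin.ofNat (k + 1) (i + 1) = Fin.ofNat (k + 1) i + 1 := fun i ↦ by
    ext
    simp [Fin.val_add, Fin.ofNat]
  have hreach := reaches_sum (C := lagrangianProduct K T)
    (z := fun i ↦ WithLp.toLp 2 (q (Fin.ofNat (k + 1) i), p (Fin.ofNat (k + 1) i)))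
    (σ := fun i ↦ σ (Fin.ofNat (k + 1) i)) (fun i ↦ by simpa only [hnat] using hstep _) k
  have hend : Fin.ofNat (k + 1) (k + 1) = Fin.ofNat (k + 1) 0 := by
    ext
    simp [Fin.ofNat]
  -- The q-segments and the p-segments each take total time ℓ_T(q), so half the period is the
  -- length.
  have htime : ∑ i ∈ Finset.range (k + 1), σ (Fin.ofNat (k + 1) i) =
      2 * loopLength T q := by
    rw [← Fin.sum_univ_eq_sum_range (fun i ↦ σ (Fin.ofNat (k + 1) i)) (k + 1), two_mul]
    nth_rewrite 2 [← hsum]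
    rw [loopLength, ← Finset.sum_add_distrib]
    refine Finset.sum_congr rfl fun j _ ↦ ?_
    have : Fin.ofNat (k + 1) j.val = j := by
      ext
      simp [Fin.ofNat, Nat.mod_eq_of_lt j.isLt]
    rw [this]
  rw [hend, htime] at hreach
  obtain ⟨x, hx⟩ := hreach.exists_isClosedCharacteristic (mul_pos two_pos hpos)
  refine ⟨_, x, hx, ?_⟩
  rw [hx.action_eq, mul_div_cancel_left₀ _ two_ne_zero]

end Construction

end MinkowskiBilliards

end

/-! ### The four minima together -/

open MinkowskiBilliards in
theorem theorem1p1 (n : ℕ) (hn : 1 ≤ n) (K T : ConvexBody (EuclideanSpace ℝ (Fin n)))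
    (hK : (0 : EuclideanSpace ℝ (Fin n)) ∈ interior (K : Set (EuclideanSpace ℝ (Fin n))))
    (hT : (0 : EuclideanSpace ℝ (Fin n)) ∈ interior (T : Set (EuclideanSpace ℝ (Fin n)))) :
    IsLeast (characteristicActions (lagrangianProduct (K : Set (EuclideanSpace ℝ (Fin n))) T))
        (cEHZ (lagrangianProduct (K : Set (EuclideanSpace ℝ (Fin n))) T)) ∧
      IsLeast (MinkowskiBilliards.length (T : Set (EuclideanSpace ℝ (Fin n))) '' F (n + 1) K)
        (cEHZ (lagrangianProduct (K : Set (EuclideanSpace ℝ (Fin n))) T)) ∧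
      IsLeast (MinkowskiBilliards.length (K : Set (EuclideanSpace ℝ (Fin n))) '' F (n + 1) T)
        (cEHZ (lagrangianProduct (K : Set (EuclideanSpace ℝ (Fin n))) T)) ∧
      IsLeast (MinkowskiBilliards.length (T : Set (EuclideanSpace ℝ (Fin n))) '' M (n + 1) K T)
        (cEHZ (lagrangianProduct (K : Set (EuclideanSpace ℝ (Fin n))) T)) := by
  have hK' : IsBody (K : Set (EuclideanSpace ℝ (Fin n))) := ⟨K.convex, K.isCompact, hK⟩
  have hT' : IsBody (T : Set (EuclideanSpace ℝ (Fin n))) := ⟨T.convex, T.isCompact, hT⟩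
  have hrank : Module.finrank ℝ (EuclideanSpace ℝ (Fin n)) = n := finrank_euclideanSpace_fin
  have : Nontrivial (EuclideanSpace ℝ (Fin n)) :=
    Module.nontrivial_of_finrank_pos (R := ℝ) (by omega)
  obtain ⟨L, hF, hF', hM, hmin⟩ := exists_isLeast_length hK' hT' hn
  have hc : IsLeast
      (characteristicActions (lagrangianProduct (K : Set (EuclideanSpace ℝ (Fin n))) T)) L := by
    constructor
    · obtain ⟨r, hr, rfl⟩ := hM.1
      obtain ⟨τ, x, hx, hA⟩ := hr.2.exists_isClosedCharacteristic hK' hT'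
      exact ⟨τ, x, hx, hA.symm⟩
    · rintro _ ⟨τ, x, hx, rfl⟩
      exact hx.le_action hK' hT' hrank.le hmin
  have hL : cEHZ (lagrangianProduct (K : Set (EuclideanSpace ℝ (Fin n))) T) = L :=
    hc.csInf_eq
  rw [hL]
  exact ⟨hc, hF, hF', hM⟩
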